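/- Let $\mathbb{F}_q$ be a finite field with $q$ elements and algebraic closure $\overline{\mathbb{F}}_q$. Let $a, b, k$ be positive integers with $a \le b$, put $d = k\,\mathrm{lcm}(a,b)$, and assume $d \le q$. Write $(a_0,a_1,a_2) = (1,a,b)$. Let $\mathbb{P}(1,a,b) = (\overline{\mathbb{F}}_q^{3}\setminus\{0\})/\sim$, where $(x_0,x_1,x_2) \sim (\lambda x_0, \lambda^{a} x_1, \lambda^{b} x_2)$ for every $\lambda \in \overline{\mathbb{F}}_q^{*}$. A point $(x_0:x_1:x_2)$ is called $\mathbb{F}_q$-rational if $(x_0:x_1:x_2) = (x_0^q:x_1^q:x_2^q)$; let $\mathbb{P}(1,a,b)(\mathbb{F}_q)$ be the set of these points. Let $\mathsf{S}_d$ be the $\mathbb{F}_q$-vector space of all polynomials in $\mathbb{F}_q[X_0,X_1,X_2]$ that are homogeneous of degree $d$ when $X_i$ is given degree $a_i$ for $i=0,1,2$ (including the zero polynomial). For $F \in \mathsf{S}_d$ and a rational point $x = (x_0:x_1:x_2)$ put $c_x(F) = F(x_0,x_1,x_2)/x_i^{d/a_i}$, where $i$ is the least index with $x_i \neq 0$;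 this is an element of $\mathbb{F}_q$ that does not depend on the choice of coordinates of $x$. The weighted projective Reed--Muller code $\mathrm{WPRM}_q(d,2;(1,a,b))$ is the image of the linear map $\mathsf{S}_d \to \mathbb{F}_q^{\mathbb{P}(1,a,b)(\mathbb{F}_q)}$, $F \mapsto (c_x(F))_x$. Then this code has length $\#\mathbb{P}(1,a,b)(\mathbb{F}_q) = p_2 = q^2+q+1$, its dimension over $\mathbb{F}_q$ is $$\frac{(d+2a)(d+b) + (\gcd(a,b)-a)\,d}{2ab},$$ and its minimum distance (the least number of nonzero coordinates of a nonzero codeword) is $$q^2 - \left(\frac{d}{a}-1\right)q.$$ -/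

import Mathlib

namespace WProj

variable {F : Type*} [Field F] {m : ℕ}

/-- Nonzero vectors of `F̄ ^ (m + 1)`, where `F̄` is the algebraic closure of `F`. -/
abbrev Vec (F : Type*) [Field F] (m : ℕ) : Type _ :=
  {x : Fin (m + 1) → AlgebraicClosure F // x ≠ 0}

/-- `x ∼ y` when `y = (t ^ a₀ x₀, …, t ^ aₘ xₘ)` for some nonzero `t` of `F̄`. -/
def setoid (F : Type*) [Field F] {m : ℕ} (a : Fin (m + 1) → ℕ) : Setoid (Vec F m) where
  r x y := ∃ t : AlgebraicClosure F, t ≠ 0 ∧ ∀ i, y.1 i = t ^ a i * x.1 i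
  iseqv :=
    { refl := fun x => ⟨1, one_ne_zero, fun i => by simp⟩
      symm := by
        rintro x y ⟨t, ht, h⟩
        refine ⟨t⁻¹, inv_ne_zero ht, fun i => ?_⟩
        rw [h i, ← mul_assoc, ← mul_pow, inv_mul_cancel₀ ht, one_pow, one_mul]
      trans := by
        rintro x y z ⟨t, ht, h⟩ ⟨s, hs, h'⟩
        refine ⟨s * t, mul_ne_zero hs ht, fun i => ?_⟩
        rw [h' i, h i, mul_pow, mul_assoc] }

/-- The weighted projective space `ℙ(a₀, …, aₘ)` (its points over `F̄`). -/
def WPSpace (F : Type*) [Field F] {m : ℕ} (a : Fin (m + 1) → ℕ) : Type _ :=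
  Quotient (setoid F a)

open Classical in
/-- The index of the first nonzero coordinate: `lead x = i` iff `x ∈ Wᵢ`. -/
noncomputable def lead (x : Vec F m) : Fin (m + 1) :=
  (Finset.univ.filter fun i => x.1 i ≠ 0).min' (by
    obtain ⟨i, hi⟩ := Function.ne_iff.mp x.2
    exact ⟨i, by simpa using hi⟩)

theorem lead_eq {x y : Vec F m} (h : ∀ i, x.1 i = 0 ↔ y.1 i = 0) : lead x = lead y := by
  unfold lead
  congr 1
  ext i
  simp [h i]

theorem lead_ne_zero (x : Vec F m) : x.1 (lead x) ≠ 0 := by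
  classical
  have h : lead x ∈ Finset.univ.filter fun i => x.1 i ≠ 0 := by
    unfold lead
    convert Finset.min'_mem _ _
  exact (Finset.mem_filter.mp h).2

/-- `Sd F a d` is the space of polynomials over `F` that are homogeneous of degree `d` when
`Xᵢ` has degree `aᵢ`. -/
abbrev Sd (F : Type*) [Field F] {m : ℕ} (a : Fin (m + 1) → ℕ) (d : ℕ) :
    Submodule F (MvPolynomial (Fin (m + 1)) F) :=
  MvPolynomial.weightedHomogeneousSubmodule F a d

/-- `p(x₀, …, xₘ) / xᵢ ^ (d / aᵢ)` for `x ∈ Wᵢ`. -/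
noncomputable def normEval (a : Fin (m + 1) → ℕ) (d : ℕ) (p : MvPolynomial (Fin (m + 1)) F)
    (x : Vec F m) : AlgebraicClosure F :=
  MvPolynomial.aeval x.1 p / x.1 (lead x) ^ (d / a (lead x))

theorem aeval_smul {a : Fin (m + 1) → ℕ} {d : ℕ} {p : MvPolynomial (Fin (m + 1)) F}
    (hp : p ∈ Sd F a d) (x y : Fin (m + 1) → AlgebraicClosure F) (t : AlgebraicClosure F)
    (h : ∀ i, y i = t ^ a i * x i) :
    MvPolynomial.aeval y p = t ^ d * MvPolynomial.aeval x p := by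
  rw [MvPolynomial.aeval_def, MvPolynomial.aeval_def, MvPolynomial.eval₂_eq',
    MvPolynomial.eval₂_eq', Finset.mul_sum]
  refine Finset.sum_congr rfl fun e he => ?_
  have hw : Finsupp.weight a e = d := hp (MvPolynomial.mem_support_iff.mp he)
  have hw' : d = ∑ i, a i * e i := by
    rw [← hw, Finsupp.weight_apply, Finsupp.sum_fintype _ _ (by simp)]
    exact Finset.sum_congr rfl fun i _ => by rw [smul_eq_mul, mul_comm]
  have : ∏ i, y i ^ e i = t ^ d * ∏ i, x i ^ e i := by
    rw [hw', ← Finset.prod_pow_eq_pow_sum, ← Finset.prod_mul_distrib]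
    exact Finset.prod_congr rfl fun i _ => by rw [h i, mul_pow, pow_mul]
  rw [this, mul_left_comm]

theorem normEval_congr {a : Fin (m + 1) → ℕ} {d : ℕ} (hd : ∀ i, a i ∣ d)
    {p : MvPolynomial (Fin (m + 1)) F} (hp : p ∈ Sd F a d) {x y : Vec F m}
    (h : (setoid F a).r x y) : normEval a d p x = normEval a d p y := by
  obtain ⟨t, ht, h⟩ := h
  have hl : lead y = lead x := lead_eq fun i => by
    rw [h i, mul_eq_zero, or_iff_right (pow_ne_zero _ ht)]
  rw [normEval, normEval, aeval_smul hp x.1 y.1 t h, hl, h, mul_pow, ← pow_mul,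
    Nat.mul_div_cancel' (hd _), mul_div_mul_left _ _ (pow_ne_zero _ ht)]

/-- The value `c_P(p)` at a point `P` of `ℙ(a₀, …, aₘ)`, which does not depend on the choice of
homogeneous coordinates of `P`. -/
noncomputable def pointEval (a : Fin (m + 1) → ℕ) (d : ℕ) (hd : ∀ i, a i ∣ d) (p : Sd F a d)
    (P : WPSpace F a) : AlgebraicClosure F :=
  Quotient.lift (normEval a d p.1) (fun _ _ h => normEval_congr hd p.2 h) P

theorem pointEval_add {a : Fin (m + 1) → ℕ} {d : ℕ} (hd : ∀ i, a i ∣ d) (p r : Sd F a d)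
    (P : WPSpace F a) :
    pointEval a d hd (p + r) P = pointEval a d hd p P + pointEval a d hd r P := by
  induction P using Quotient.inductionOn with
  | h x =>
    change normEval a d (p.1 + r.1) x = normEval a d p.1 x + normEval a d r.1 x
    rw [normEval, map_add, add_div]
    rfl

theorem pointEval_smul {a : Fin (m + 1) → ℕ} {d : ℕ} (hd : ∀ i, a i ∣ d) (c : F) (p : Sd F a d)
    (P : WPSpace F a) :
    pointEval a d hd (c • p) P =
      algebraMap F (AlgebraicClosure F) c * pointEval a d hd p P := by
  induction P using Quotient.inductionOn with
  | h x =>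
    change normEval a d (c • p.1) x = algebraMap F (AlgebraicClosure F) c * normEval a d p.1 x
    rw [normEval, map_smul, Algebra.smul_def, mul_div_assoc]
    rfl

variable [Fintype F]

/-- The coordinatewise `q`-th power of a nonzero vector, `q = #F`. -/
noncomputable def frobVec (x : Vec F m) : Vec F m :=
  ⟨fun i => x.1 i ^ Fintype.card F, fun h => x.2 (funext fun i =>
    eq_zero_of_pow_eq_zero (congrFun h i))⟩

/-- The map `(x₀ : ⋯ : xₘ) ↦ (x₀ ^ q : ⋯ : xₘ ^ q)` on `ℙ(a₀, …, aₘ)`. -/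
noncomputable def frob (a : Fin (m + 1) → ℕ) : WPSpace F a → WPSpace F a :=
  Quotient.map frobVec (by
    rintro x y ⟨t, ht, h⟩
    refine ⟨t ^ Fintype.card F, pow_ne_zero _ ht, fun i => ?_⟩
    simp only [frobVec, h i, mul_pow]
    rw [← pow_mul, ← pow_mul, mul_comm (a i)])

/-- The `F`-rational points of `ℙ(a₀, …, aₘ)`. -/
def RatPoint (F : Type*) [Field F] [Fintype F] {m : ℕ} (a : Fin (m + 1) → ℕ) : Type _ :=
  {P : WPSpace F a // frob a P = P}

theorem exists_of_pow_card {z : AlgebraicClosure F} (hz : z ^ Fintype.card F = z) :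
    ∃ c : F, algebraMap F (AlgebraicClosure F) c = z := by
  have h1 : 1 < Fintype.card F := Fintype.one_lt_card
  have hr := FiniteField.roots_X_pow_card_sub_X F
  have hc : (Polynomial.X ^ Fintype.card F - Polynomial.X : Polynomial F).roots.card =
      (Polynomial.X ^ Fintype.card F - Polynomial.X : Polynomial F).natDegree := by
    rw [hr, FiniteField.X_pow_card_sub_X_natDegree_eq F h1]
    rfl
  have hm := Polynomial.roots_map_of_injective_of_card_eq_natDegree
    (algebraMap F (AlgebraicClosure F)).injective hc
  have : z ∈ ((Polynomial.X ^ Fintype.card F - Polynomial.X : Polynomial F).map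
      (algebraMap F (AlgebraicClosure F))).roots := by
    rw [Polynomial.mem_roots']
    refine ⟨?_, by simp [hz]⟩
    rw [Ne, Polynomial.map_eq_zero]
    exact FiniteField.X_pow_card_sub_X_ne_zero F h1
  rw [← hm, Multiset.mem_map] at this
  obtain ⟨c, -, hc⟩ := this
  exact ⟨c, hc⟩

theorem pointEval_rational {a : Fin (m + 1) → ℕ} {d : ℕ} (hd : ∀ i, a i ∣ d) (p : Sd F a d)
    (P : RatPoint F a) :
    ∃ c : F, algebraMap F (AlgebraicClosure F) c = pointEval a d hd p P.1 := by
  obtain ⟨P, hP⟩ := P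
  apply exists_of_pow_card
  have key : pointEval a d hd p P ^ Fintype.card F = pointEval a d hd p (frob a P) := by
    induction P using Quotient.inductionOn with
    | h x =>
      change normEval a d p.1 x ^ Fintype.card F = normEval a d p.1 (frobVec x)
      have hl : lead (frobVec x) = lead x := lead_eq fun i => by
        simp [frobVec, pow_eq_zero_iff Fintype.card_ne_zero]
      have hx : (frobVec x).1 = fun i =>
          FiniteField.frobeniusAlgHom F (AlgebraicClosure F) (x.1 i) := rfl
      have he : MvPolynomial.aeval (frobVec x).1 p.1 =
          (MvPolynomial.aeval x.1 p.1) ^ Fintype.card F := by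
        rw [hx]
        exact DFunLike.congr_fun (MvPolynomial.comp_aeval x.1
          (FiniteField.frobeniusAlgHom F (AlgebraicClosure F))) p.1 |>.symm
      rw [normEval, normEval, he, hl, div_pow]
      congr 1
      change _ = (x.1 (lead x) ^ Fintype.card F) ^ _
      rw [← pow_mul, ← pow_mul, mul_comm]
  rw [key, hP]

/-- The evaluation map `p ↦ (c_P(p))_P`, where `P` runs over the rational points. Each
`c_P(p)` lies in `F`. -/
noncomputable def evalMap (a : Fin (m + 1) → ℕ) (d : ℕ) (hd : ∀ i, a i ∣ d) :
    Sd F a d →ₗ[F] (RatPoint F a → F) where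
  toFun p P := (pointEval_rational hd p P).choose
  map_add' p r := by
    funext P
    apply (algebraMap F (AlgebraicClosure F)).injective
    rw [Pi.add_apply, map_add, (pointEval_rational hd (p + r) P).choose_spec,
      (pointEval_rational hd p P).choose_spec, (pointEval_rational hd r P).choose_spec,
      pointEval_add]
  map_smul' c p := by
    funext P
    apply (algebraMap F (AlgebraicClosure F)).injective
    rw [Pi.smul_apply, smul_eq_mul, map_mul, (pointEval_rational hd (c • p) P).choose_spec,
      RingHom.id_apply, (pointEval_rational hd p P).choose_spec, pointEval_smul]

theorem algebraMap_evalMap {a : Fin (m + 1) → ℕ} {d : ℕ} (hd : ∀ i, a i ∣ d) (p : Sd F a d)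
    (P : RatPoint F a) :
    algebraMap F (AlgebraicClosure F) (evalMap a d hd p P) = pointEval a d hd p P.1 :=
  (pointEval_rational hd p P).choose_spec

/-- The weighted projective Reed–Muller code of order `d` over `ℙ(a₀, …, aₘ)`, a linear code in
the space of functions from the set of rational points to `F`. -/
noncomputable def WPRM (F : Type*) [Field F] [Fintype F] {m : ℕ} (a : Fin (m + 1) → ℕ) (d : ℕ)
    (hd : ∀ i, a i ∣ d) : Submodule F (RatPoint F a → F) :=
  LinearMap.range (evalMap a d hd)

/-- Every rational point has coordinates in `F`. -/
theorem exists_rep (a : Fin (m + 1) → ℕ) (P : RatPoint F a) :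
    ∃ v : Fin (m + 1) → F,
      ∃ hv : (fun i => algebraMap F (AlgebraicClosure F) (v i)) ≠ 0,
        P.1 = Quotient.mk (setoid F a) ⟨_, hv⟩ := by
  obtain ⟨P, hP⟩ := P
  induction P using Quotient.inductionOn with
  | h x =>
    have h1 : 1 < Fintype.card F := Fintype.one_lt_card
    obtain ⟨t, ht, h⟩ := Quotient.exact hP
    obtain ⟨u, hu⟩ := IsAlgClosed.exists_pow_nat_eq t (n := Fintype.card F - 1) (by omega)
    have hu0 : u ≠ 0 := by
      rintro rfl
      rw [zero_pow (by omega)] at hu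
      exact ht hu.symm
    have huq : u ^ Fintype.card F = u * t := by
      rw [← hu, ← pow_succ', Nat.sub_add_cancel h1.le]
    have hfix : ∀ i, (u ^ a i * x.1 i) ^ Fintype.card F = u ^ a i * x.1 i := by
      intro i
      have hi : x.1 i = t ^ a i * x.1 i ^ Fintype.card F := h i
      rw [mul_pow, ← pow_mul, mul_comm (a i), pow_mul, huq, mul_pow, mul_assoc, ← hi]
    choose v hv using fun i => exists_of_pow_card (hfix i)
    have hv0 : (fun i => algebraMap F (AlgebraicClosure F) (v i)) ≠ 0 := by
      obtain ⟨i, hi⟩ := Function.ne_iff.mp x.2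
      refine Function.ne_iff.mpr ⟨i, ?_⟩
      change algebraMap F (AlgebraicClosure F) (v i) ≠ 0
      rw [hv i]
      exact mul_ne_zero (pow_ne_zero _ hu0) hi
    exact ⟨v, hv0, Quotient.sound ⟨u, hu0, hv⟩⟩

instance (a : Fin (m + 1) → ℕ) : Finite (RatPoint F a) := by
  refine Finite.of_injective (β := Fin (m + 1) → F) (fun P => (exists_rep a P).choose) ?_
  intro P Q h
  obtain ⟨h1, h2⟩ := (exists_rep a P).choose_spec
  obtain ⟨h3, h4⟩ := (exists_rep a Q).choose_spec
  apply Subtype.ext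
  rw [h2, h4]
  congr 2
  funext i
  exact congrArg _ (congrFun h i)

noncomputable instance (a : Fin (m + 1) → ℕ) : Fintype (RatPoint F a) :=
  Fintype.ofFinite _

open Classical in
/-- `δ` is the minimum distance of the linear code `C`: the least Hamming weight of a nonzero
codeword. -/
def IsMinDist {ι K : Type*} [Fintype ι] [Field K] (C : Submodule K (ι → K)) (δ : ℕ) : Prop :=
  IsLeast {w | ∃ c ∈ C, c ≠ 0 ∧ hammingNorm c = w} δ

theorem dvd_of_eq_mul_lcm {a b d k : ℕ} (h : d = k * Nat.lcm a b) :
    ∀ i, (![1, a, b] : Fin 3 → ℕ) i ∣ d := by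
  subst h
  intro i
  fin_cases i
  · exact one_dvd _
  · exact (Nat.dvd_lcm_left a b).mul_left k
  · exact (Nat.dvd_lcm_right a b).mul_left k

end WProj

/-! Write `a = g a'`, `b = g b'` with `a'`, `b'` coprime, and `D = d / a = k b'`. The rational
points are the affine plane `x₀ = 1`, the point `(0 : 1 : 0)`, and the points at infinity with `x₂ ≠
0`. The last are classified by `z = x₁ ^ b' / x₂ ^ a'` in `F`, so the total is `q² + 1 + q`.

The core is that a nonzero form has at most `D q + 1` rational zeros (`zeros_le`). Let `f = p(1, x₁,
x₂)`; its part of weight `d` becomes a polynomial in `z`, `topPoly`, whose roots are the zeros at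
infinity other than `(0 : 1 : 0)`.

If `x₁ ^ D` does not occur in `f`, then `f` has degree `i < D` in `x₁`. Its leading coefficient has
degree at most `D - i` in `x₂`, so few lines `x₂ = u` carry more than `i` zeros, and counting along
these lines suffices (`zeros_le_of_natDegree_lt`).

If `x₁ ^ D` occurs and `a < b`, each line carries at most `D` zeros. Too many zeros would make `f(·,
u)` split into distinct factors over `F` for many `u`. Dividing `x₁ ^ q` by `f` while tracking
weights then gives `f ∣ x₁ ^ q - x₁`, so `x₂` does not occur in `f` and `topPoly` is a monomial,
with only one root (`zeros_le_of_coeff_ne_zero`). If `a = b`, a linear change of coordinates moves a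
zero at infinity to `(0 : 1 : 0)` and reduces to the first case; without such a zero, the bound by
lines is enough.

A product of `D` curves `x₁ = c x₀ ^ a` attains the bound. As the bound is below the number of
points, evaluation is injective, and the dimension is the number of lattice points in a triangle. -/

namespace WProj

open Polynomial

/-! ### Zeros of bivariate polynomials of bounded weight -/

/-- The polynomial `f(x₁, x₂)`, with outer variable `x₁` of weight `a` and inner variable `x₂` of
weight `b`, has weighted degree at most `w`. -/
def WtLE {F : Type*} [Field F] (a b w : ℕ) (f : F[X][X]) : Prop :=
  ∀ i j, (f.coeff i).coeff j ≠ 0 → a * i + b * j ≤ w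

/-- The zeros of `f` in the affine plane. -/
noncomputable def affZeros {F : Type*} [Field F] [Fintype F] (f : F[X][X]) : ℕ :=
  Nat.card {v : F × F // (f.map (evalRingHom v.2)).eval v.1 = 0}

/-- The part of `f` of weight `d`, as a polynomial in `z = x₁ ^ b' / x₂ ^ a'`. -/
noncomputable def topPoly {F : Type*} [Field F] (a' b' k : ℕ) (f : F[X][X]) : F[X] :=
  ∑ m ∈ Finset.range (k + 1), C ((f.coeff (m * b')).coeff ((k - m) * a')) * X ^ m

section Bivariate

variable {F : Type*} [Field F]

theorem topPoly_coeff (a' b' k : ℕ) (f : F[X][X]) (m : ℕ) (hm : m ≤ k) :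
    (topPoly a' b' k f).coeff m = (f.coeff (m * b')).coeff ((k - m) * a') := by
  unfold topPoly
  simp only [finsetSum_coeff, coeff_C_mul, coeff_X_pow]
  rw [Finset.sum_eq_single m]
  · simp
  · intro n _ hn
    simp [hn.symm]
  · intro h
    exact absurd (Finset.mem_range.mpr (by omega)) h

theorem natDegree_topPoly_le (a' b' k : ℕ) (f : F[X][X]) : (topPoly a' b' k f).natDegree ≤ k := by
  unfold topPoly
  refine natDegree_sum_le_of_forall_le _ _ fun m hm => ?_
  exact (natDegree_C_mul_X_pow_le _ _).trans (by have := Finset.mem_range.mp hm; omega)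

/-- The term `z ^ m` comes from `x₁ ^ (m b')`, and `m ≤ m b'`. -/
theorem natDegree_topPoly_le_natDegree {a' b' k : ℕ} (hb : 0 < b') (f : F[X][X]) :
    (topPoly a' b' k f).natDegree ≤ f.natDegree := by
  by_contra! h
  have h0 : topPoly a' b' k f ≠ 0 := by
    intro h0
    rw [h0] at h
    simp at h
  have h1 := leadingCoeff_ne_zero.mpr h0
  rw [leadingCoeff, topPoly_coeff _ _ _ _ _ (natDegree_topPoly_le a' b' k f)] at h1
  apply h1
  rw [coeff_eq_zero_of_natDegree_lt (p := f), coeff_zero]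
  exact h.trans_le (Nat.le_mul_of_pos_right _ hb)

theorem WtLE.natDegree_coeff_le {a b w : ℕ} {f : F[X][X]} (h : WtLE a b w f) {i : ℕ}
    (hi : f.coeff i ≠ 0) : a * i + b * (f.coeff i).natDegree ≤ w :=
  h i _ (leadingCoeff_ne_zero.mpr hi)

theorem WtLE.sub {a b w : ℕ} {f g : F[X][X]} (hf : WtLE a b w f) (hg : WtLE a b w g) :
    WtLE a b w (f - g) := by
  intro i j hij
  by_contra hc
  have h1 : (f.coeff i).coeff j = 0 := by_contra fun h => hc (hf i j h)
  have h2 : (g.coeff i).coeff j = 0 := by_contra fun h => hc (hg i j h)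
  exact hij (by simp [h1, h2])

theorem WtLE.X_mul {a b w : ℕ} {f : F[X][X]} (hf : WtLE a b w f) : WtLE a b (w + a) (X * f) := by
  intro i j hij
  cases i with
  | zero => simp at hij
  | succ i =>
    rw [coeff_X_mul] at hij
    have := hf i j hij
    rw [mul_add]
    omega

theorem WtLE.C_mul {a b w w' : ℕ} {f : F[X][X]} (hf : WtLE a b w f) {g : F[X]}
    (hg : ∀ j, g.coeff j ≠ 0 → b * j ≤ w') : WtLE a b (w + w') (C g * f) := by
  intro i j hij
  rw [coeff_C_mul, coeff_mul] at hij
  obtain ⟨⟨s, t⟩, hst, hne⟩ := Finset.exists_ne_zero_of_sum_ne_zero hij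
  have h1 : b * s ≤ w' := hg s (left_ne_zero_of_mul hne)
  have h2 : a * i + b * t ≤ w := hf i t (right_ne_zero_of_mul hne)
  have h3 : s + t = j := Finset.HasAntidiagonal.mem_antidiagonal.mp hst
  rw [← h3, mul_add]
  omega

/-- Division of `x₁ ^ n` by a polynomial whose leading coefficient in `x₁` is `1`. -/
theorem exists_remainder_X_pow {a b D : ℕ} (hD : 0 < D) {f : F[X][X]} (hf : WtLE a b (a * D) f)
    (hdeg : f.natDegree ≤ D) (hlead : f.coeff D = 1) (n : ℕ) :
    ∃ R : F[X][X], WtLE a b (a * n) R ∧ (∀ i, D ≤ i → R.coeff i = 0) ∧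
      f ∣ X ^ n - R := by
  induction n with
  | zero =>
    refine ⟨1, ?_, ?_, by simp⟩
    · intro i j hij
      rw [coeff_one] at hij
      split_ifs at hij with hi
      · rw [coeff_one] at hij
        split_ifs at hij with hj
        · subst hi hj
          simp
        · exact absurd rfl hij
      · simp at hij
    · intro i hi
      rw [coeff_one, if_neg (by omega)]
  | succ n ih =>
    obtain ⟨R, hR, hRD, Q, hQ⟩ := ih
    -- One step of long division: only the coefficient of `x₁ ^ D` in `X * R` has to be cancelled,
    -- and `f` is monic there.
    refine ⟨X * R - C (R.coeff (D - 1)) * f, ?_, ?_, X * Q + C (R.coeff (D - 1)), ?_⟩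
    · by_cases h0 : R.coeff (D - 1) = 0
      · simpa [h0, mul_add] using hR.X_mul
      · have h1 : a * (D - 1) ≤ a * n := by
          have := hR.natDegree_coeff_le h0
          omega
        have h2 : a * D = a * (D - 1) + a := by
          rw [← Nat.mul_succ, Nat.succ_eq_add_one, Nat.sub_add_cancel hD]
        have h3 : WtLE a b (a * D + (a * n - a * (D - 1))) (C (R.coeff (D - 1)) * f) := by
          refine hf.C_mul fun j hj => ?_
          have := hR _ _ hj
          omega
        have h4 : a * D + (a * n - a * (D - 1)) = a * n + a := by omega
        rw [h4] at h3
        rw [Nat.mul_succ]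
        exact hR.X_mul.sub h3
    · intro i hi
      obtain ⟨i, rfl⟩ : ∃ i', i = i' + 1 := ⟨i - 1, by omega⟩
      rw [coeff_sub, coeff_X_mul, coeff_C_mul]
      rcases hi.eq_or_lt with h | h
      · rw [← h, hlead, mul_one, show D - 1 = i by omega, sub_self]
      · rw [hRD i (by omega), coeff_eq_zero_of_natDegree_lt (p := f) (by omega), mul_zero, sub_zero]
    · linear_combination X * hQ

theorem coeff_coeff_swap (f : F[X][X]) (i j : ℕ) :
    ((Bivariate.swap f).coeff j).coeff i = (f.coeff i).coeff j := by
  induction f using Polynomial.induction_on' with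
  | add p q hp hq => simp only [map_add, coeff_add, hp, hq]
  | monomial n g =>
    induction g using Polynomial.induction_on' with
    | add p q hp hq => simp only [map_add, coeff_add, hp, hq]
    | monomial m r =>
      rw [Bivariate.swap_monomial_monomial]
      simp only [coeff_monomial]
      split_ifs <;> simp_all [coeff_monomial]

/-- A divisor of a nonzero polynomial in `x₁` alone does not involve `x₂`. -/
theorem coeff_coeff_eq_zero_of_dvd_map_C {f : F[X][X]} {p : F[X]} (hp : p ≠ 0)
    (h : f ∣ p.map C) (i : ℕ) {j : ℕ} (hj : 0 < j) : (f.coeff i).coeff j = 0 := by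
  obtain ⟨Q, hQ⟩ := h
  -- With the variables exchanged, the multiple of `f` has degree `0` in the outer variable `x₂`,
  -- and degrees of divisors can only be smaller.
  have h1 : (C p : F[X][X]) = Bivariate.swap f * Bivariate.swap Q := by
    rw [← map_mul, ← hQ, Bivariate.swap_map_C]
  have h0 : (C p : F[X][X]) ≠ 0 := C_ne_zero.mpr hp
  have h2 : (Bivariate.swap f).natDegree ≤ (C p : F[X][X]).natDegree :=
    natDegree_le_of_dvd ⟨_, h1⟩ h0
  rw [natDegree_C] at h2
  rw [← coeff_coeff_swap, coeff_eq_zero_of_natDegree_lt (p := Bivariate.swap f) (by omega),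
    coeff_zero]

variable [Fintype F]

theorem card_zeros_le {p : F[X]} (hp : p ≠ 0) : Nat.card {x : F // p.eval x = 0} ≤ p.natDegree := by
  classical
  have h : Nat.card {x : F // p.eval x = 0} = p.roots.toFinset.card := by
    rw [Nat.card_eq_fintype_card]
    exact Fintype.card_of_subtype _ fun x => by simp [hp]
  rw [h]
  exact (Multiset.toFinset_card_le _).trans (card_roots' p)

theorem card_zeros_le_card (p : F[X]) : Nat.card {x : F // p.eval x = 0} ≤ Fintype.card F := by
  rw [← Nat.card_eq_fintype_card]
  exact Nat.card_le_card_of_injective _ Subtype.val_injective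

theorem affZeros_eq_sum (f : F[X][X]) :
    affZeros f = ∑ u : F, Nat.card {x : F // (f.map (evalRingHom u)).eval x = 0} := by
  rw [affZeros, ← Nat.card_sigma]
  exact Nat.card_congr
    { toFun := fun v => ⟨v.1.2, v.1.1, v.2⟩
      invFun := fun v => ⟨(v.2.1, v.1), v.2.2⟩
      left_inv := fun _ => rfl
      right_inv := fun _ => rfl }

/-- The bound for the zeros of a form whose degree in `x₁` is less than `d / a`. -/
theorem zeros_le_of_natDegree_lt {a b a' b' k d D : ℕ} (hb : 0 < b') (hab : a ≤ b) (ha : 0 < a)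
    (hd : d = a * D) (hDq : D ≤ Fintype.card F)
    (htop : ∀ i j, a * i + b * j = d → ∃ m ≤ k, i = m * b' ∧ j = (k - m) * a')
    {f : F[X][X]} (hf : f ≠ 0) (hwt : WtLE a b d f) (hdeg : f.natDegree < D) :
    affZeros f + Nat.card {z : F // (topPoly a' b' k f).eval z = 0} + 1 ≤
      D * Fintype.card F + 1 := by
  classical
  set q := Fintype.card F with hq
  set i := f.natDegree with hi
  set e := f.leadingCoeff.natDegree with he
  have hl : f.leadingCoeff ≠ 0 := leadingCoeff_ne_zero.mpr hf
  have hw : a * i + b * e ≤ d := hwt.natDegree_coeff_le hl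
  have hw2 : a * (i + e) ≤ a * i + b * e := by
    rw [mul_add]
    exact Nat.add_le_add_left (Nat.mul_le_mul_right _ hab) _
  have hje : (Finset.univ.filter fun u : F => f.leadingCoeff.eval u = 0).card ≤ e := by
    rw [← Fintype.card_subtype, ← Nat.card_eq_fintype_card]
    exact card_zeros_le hl
  set J := Finset.univ.filter fun u : F => f.leadingCoeff.eval u = 0 with hJ
  -- On the lines where the leading coefficient vanishes only the trivial bound `q` is used; on the
  -- others `f` keeps its degree `i`.
  have haff : affZeros f ≤ J.card * q + (q - J.card) * i := by
    have hc : Jᶜ.card = q - J.card := Finset.card_compl J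
    rw [affZeros_eq_sum, ← Finset.sum_add_sum_compl J, ← hc]
    refine Nat.add_le_add (Finset.sum_le_card_nsmul _ _ _ fun u _ => card_zeros_le_card _)
      (Finset.sum_le_card_nsmul _ _ _ fun u hu => ?_)
    have hu' : f.leadingCoeff.eval u ≠ 0 := by simpa [hJ] using hu
    refine (card_zeros_le fun h0 => hu' ?_).trans natDegree_map_le
    have := congrArg (fun g => g.coeff f.natDegree) h0
    simpa using this
  have hJq : J.card ≤ q := Finset.card_le_univ J
  have hti : topPoly a' b' k f ≠ 0 →
      Nat.card {z : F // (topPoly a' b' k f).eval z = 0} ≤ i := fun h =>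
    (card_zeros_le h).trans (natDegree_topPoly_le_natDegree hb f)
  -- For `s = J.card + i + t` the two sides differ by `t * (q - i)`. The term `i * (s - i)` is the
  -- slack that will absorb the zeros at infinity.
  have hmain : ∀ s, J.card + i ≤ s → J.card * q + (q - J.card) * i + i * (s - i) ≤ s * q := by
    intro s hs
    have hiq : i ≤ q := hdeg.le.trans hDq
    obtain ⟨t, rfl⟩ := Nat.exists_eq_add_of_le hs
    obtain ⟨r, hr⟩ := Nat.exists_eq_add_of_le hiq
    have h1 : J.card + i + t - i = J.card + t := by omega
    rw [h1]
    zify [hJq]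
    rw [hr]
    push_cast
    nlinarith [mul_nonneg (Nat.cast_nonneg (α := ℤ) t) (Nat.cast_nonneg (α := ℤ) r)]
  by_cases h0 : topPoly a' b' k f = 0
  -- A leading monomial of weight exactly `d` would appear in `topPoly`. So a whole line can be
  -- saved: `s = D - 1` works, and the spare `q` covers the trivial bound at infinity.
  · have hlt : a * i + b * e < d := by
      refine lt_of_le_of_ne hw fun h => ?_
      obtain ⟨m, hm, h1, h2⟩ := htop _ _ h
      have := topPoly_coeff a' b' k f m hm
      rw [h0, ← h1, ← h2] at this
      exact leadingCoeff_ne_zero.mpr hl this.symm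
    have h1 : i + e < D := by
      by_contra! h
      have := Nat.mul_le_mul_left a h
      omega
    have h2 := hmain (D - 1) (by omega)
    have h3 := card_zeros_le_card (topPoly a' b' k f)
    obtain ⟨D, rfl⟩ : ∃ D', D = D' + 1 := ⟨D - 1, by omega⟩
    rw [Nat.add_sub_cancel] at h2
    rw [Nat.succ_mul]
    omega
  · have h1 : i + e ≤ D := Nat.le_of_mul_le_mul_left (hw2.trans (hw.trans hd.le)) ha
    have h2 := hmain D (by omega)
    -- Since `i < D`, the slack covers the at most `i` roots of `topPoly`.
    have h3 : i ≤ i * (D - i) := Nat.le_mul_of_pos_right _ (by omega)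
    have h4 := hti h0
    omega

/-- The bound for the zeros of a form that contains a power of `x₁`, in the case `a < b`. -/
theorem zeros_le_of_coeff_ne_zero {a b a' b' k d D : ℕ} (hb : 0 < b') (hab : a < b)
    (hd : d = a * D) (hD : D = k * b') (hbk : b * k ≤ Fintype.card F)
    {f : F[X][X]} (hwt : WtLE a b d f) (hdeg : f.natDegree ≤ D) (ha' : 0 < a')
    (hlead : (f.coeff D).coeff 0 ≠ 0) :
    affZeros f + Nat.card {z : F // (topPoly a' b' k f).eval z = 0} ≤
      D * Fintype.card F + 1 := by
  classical
  set q := Fintype.card F with hq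
  have hlead' : f.coeff D ≠ 0 := fun h => hlead (by rw [h, coeff_zero])
  have hc : f.coeff D = C ((f.coeff D).coeff 0) := by
    refine eq_C_of_natDegree_eq_zero ?_
    have h1 := hwt.natDegree_coeff_le hlead'
    have h2 : b * (f.coeff D).natDegree = 0 := by omega
    exact (Nat.mul_eq_zero.mp h2).resolve_left (by omega)
  set c := (f.coeff D).coeff 0 with hcdef
  have hndeg : ∀ u : F, (f.map (evalRingHom u)).coeff D = c := fun u => by
    rw [coeff_map, hc]; simp
  have hne : ∀ u : F, f.map (evalRingHom u) ≠ 0 := fun u h => hlead (by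
    rw [← hndeg u, h, coeff_zero])
  set N : F → ℕ := fun u => Nat.card {x : F // (f.map (evalRingHom u)).eval x = 0} with hN
  have hND : ∀ u, N u ≤ D := fun u =>
    (card_zeros_le (hne u)).trans (natDegree_map_le.trans hdeg)
  have htk : Nat.card {z : F // (topPoly a' b' k f).eval z = 0} ≤ k := by
    refine (card_zeros_le fun h => hlead ?_).trans (natDegree_topPoly_le a' b' k f)
    have := topPoly_coeff a' b' k f k le_rfl
    rw [h, coeff_zero, Nat.sub_self, zero_mul, ← hD] at this
    exact this.symm
  rw [affZeros_eq_sum]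
  change (∑ u, N u) + _ ≤ _
  have hsum : ∑ u, N u ≤ D * q := by
    refine (Finset.sum_le_card_nsmul _ _ _ fun u _ => hND u).trans ?_
    rw [Finset.card_univ, smul_eq_mul, mul_comm]
  by_contra! hcon
  set U := Finset.univ.filter fun u : F => N u = D with hU
  -- Each line outside `U` loses at least one zero against `D q`, while at most `k` zeros at
  -- infinity can make up for the loss.
  have hUcard : q + 2 ≤ U.card + k := by
    have h1 : (∑ u, N u) + Uᶜ.card ≤ D * q := by
      rw [Finset.card_eq_sum_ones, ← Finset.sum_add_sum_compl U N, add_assoc,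
        ← Finset.sum_add_distrib]
      have h2 : ∑ u ∈ U, N u ≤ U.card * D :=
        Finset.sum_le_card_nsmul _ _ _ fun u _ => hND u
      have h3 : ∑ u ∈ Uᶜ, (N u + 1) ≤ Uᶜ.card * D :=
        Finset.sum_le_card_nsmul _ _ _ fun u hu => by
          have : N u ≠ D := by simpa [hU] using hu
          have := hND u
          omega
      have h4 : U.card + Uᶜ.card = q := Finset.card_add_card_compl U
      rw [mul_comm D, ← h4, add_mul]
      exact Nat.add_le_add h2 h3
    have h4 : U.card + Uᶜ.card = q := Finset.card_add_card_compl U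
    omega
  have hk2 : 2 ≤ k := by omega
  have hD2 : 2 ≤ D := by
    rw [hD]
    exact hk2.trans (Nat.le_mul_of_pos_right _ hb)
  set f' : F[X][X] := C (C c⁻¹) * f with hf'
  have hf'co : ∀ i j, (f'.coeff i).coeff j = c⁻¹ * (f.coeff i).coeff j := fun i j => by
    rw [hf', coeff_C_mul, coeff_C_mul]
  have hf'wt : WtLE a b (a * D) f' := fun i j hij => by
    rw [hf'co] at hij
    exact hd ▸ hwt i j (right_ne_zero_of_mul hij)
  have hf'deg : f'.natDegree ≤ D := (natDegree_C_mul_le _ _).trans hdeg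
  have hf'lead : f'.coeff D = 1 := by
    rw [hf', coeff_C_mul, hc, ← C_mul, inv_mul_cancel₀ hlead, C_1]
  -- `R` is `x₁ ^ q` modulo `f`. It turns out to be `X`, because `x ^ q = x` on `F`.
  obtain ⟨R, hR, hRD, hdvd⟩ := exists_remainder_X_pow (by omega) hf'wt hf'deg hf'lead q
  have hRX : R = X := by
    have hSwt : WtLE a b (a * q) (R - X) := by
      refine hR.sub fun i j hij => ?_
      have hi : i = 1 := by
        by_contra h
        rw [coeff_X_of_ne_one h] at hij
        simp at hij
      subst hi
      rw [coeff_X_one, coeff_one] at hij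
      have hj : j = 0 := by
        by_contra h
        rw [if_neg h] at hij
        exact hij rfl
      subst hj
      have : 0 < q := Fintype.card_pos
      simpa using Nat.mul_le_mul_left a this
    have hSD : ∀ i, D ≤ i → (R - X).coeff i = 0 := fun i hi => by
      rw [coeff_sub, hRD i hi, coeff_X_of_ne_one (by omega), sub_zero]
    -- For `u ∈ U` the polynomial `f(·, u)` has `D` roots in `F`; all are roots of `R - X`, whose
    -- degree in `x₁` is below `D`.
    have hSu : ∀ u ∈ U, (R - X).map (evalRingHom u) = 0 := by
      intro u hu
      have hu : N u = D := by simpa [hU] using hu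
      by_contra h0
      have h1 : N u ≤ Nat.card {x : F // ((R - X).map (evalRingHom u)).eval x = 0} := by
        refine Nat.card_mono (Set.toFinite _) fun x hx => ?_
        have hx : (f.map (evalRingHom u)).eval x = 0 := hx
        change ((R - X).map (evalRingHom u)).eval x = 0
        obtain ⟨Q, hQ⟩ := hdvd
        have h2 := congrArg (fun g => (g.map (evalRingHom u)).eval x) hQ
        simp only [hf', Polynomial.map_sub, Polynomial.map_mul, Polynomial.map_pow, map_X,
          eval_sub, eval_mul, eval_pow, eval_X, hx, hq, FiniteField.pow_card] at h2 ⊢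
        linear_combination -h2
      have h2 := h1.trans (card_zeros_le h0)
      have h3 : ((R - X).map (evalRingHom u)).natDegree < D := by
        rw [natDegree_lt_iff_degree_lt h0, degree_lt_iff_coeff_zero]
        intro m hm
        rw [coeff_map, hSD m hm, map_zero]
      omega
    rw [← sub_eq_zero]
    ext1 i
    rw [coeff_zero]
    by_contra h0
    have h1 := hSwt.natDegree_coeff_le h0
    have h2 : U.card ≤ ((R - X).coeff i).natDegree := by
      have h3 : U.card ≤ Nat.card {u : F // ((R - X).coeff i).eval u = 0} := by
        rw [Nat.card_eq_fintype_card, Fintype.card_subtype]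
        refine Finset.card_le_card fun u hu => ?_
        have h4 := congrArg (fun g => g.coeff i) (hSu u hu)
        simp only [coeff_map, coe_evalRingHom, coeff_zero] at h4
        simpa using h4
      exact h3.trans (card_zeros_le h0)
    -- A nonzero coefficient of `R - X` has degree at most `a q / b` in `x₂`, yet vanishes on `U`.
    -- This fails because `b (q + 2 - k) > a q`, by `a + 1 ≤ b` and `b k ≤ q`.
    have h3 : b * U.card ≤ a * q := (Nat.mul_le_mul_left b h2).trans (by omega)
    have h4 : b * (q + 2) ≤ b * U.card + b * k := by
      rw [← mul_add]
      exact Nat.mul_le_mul_left b hUcard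
    have h5 : (a + 1) * q ≤ b * q := Nat.mul_le_mul_right q hab
    rw [add_mul, one_mul] at h5
    rw [mul_add] at h4
    omega
  have hdvd' : f ∣ (X ^ q - X : F[X]).map C := by
    rw [hRX] at hdvd
    rw [Polynomial.map_sub, Polynomial.map_pow, map_X]
    exact (Dvd.intro_left _ rfl).trans hdvd
  have hconst := coeff_coeff_eq_zero_of_dvd_map_C
    (FiniteField.X_pow_card_sub_X_ne_zero F Fintype.one_lt_card) hdvd'
  -- Every term with `m < k` involves `x₂`, so it is absent.
  have htop : topPoly a' b' k f = C c * X ^ k := by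
    rw [topPoly, Finset.sum_eq_single_of_mem k (Finset.self_mem_range_succ k)]
    · rw [Nat.sub_self, zero_mul, ← hD]
    · intro m hm hmk
      rw [hconst _ (Nat.mul_pos (by have := Finset.mem_range.mp hm; omega) ha')]
      simp
  have ht1 : Nat.card {z : F // (topPoly a' b' k f).eval z = 0} ≤ 1 := by
    rw [Finite.card_le_one_iff_subsingleton]
    refine ⟨fun z w => Subtype.ext ?_⟩
    have hz : ∀ v : {z : F // (topPoly a' b' k f).eval z = 0}, v.1 = 0 := by
      rintro ⟨v, hv⟩
      rw [htop] at hv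
      simpa [hlead, show k ≠ 0 by omega] using hv
    rw [hz, hz]
  omega

end Bivariate

/-! ### Arithmetic of the weights -/

/-- The arithmetic of the weights: `a = g a'` and `b = g b'` with `a'` and `b'` coprime, and
`d = k lcm(a, b)`. -/
structure IsWeights (g a' b' k a b d : ℕ) : Prop where
  g_pos : 0 < g
  a'_pos : 0 < a'
  b'_pos : 0 < b'
  k_pos : 0 < k
  coprime : Nat.Coprime a' b'
  a_eq : a = g * a'
  b_eq : b = g * b'
  d_eq : d = k * (g * a' * b')

namespace IsWeights

variable {g a' b' k a b d : ℕ}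

theorem a_pos (h : IsWeights g a' b' k a b d) : 0 < a := h.a_eq ▸ Nat.mul_pos h.g_pos h.a'_pos

theorem b_pos (h : IsWeights g a' b' k a b d) : 0 < b := h.b_eq ▸ Nat.mul_pos h.g_pos h.b'_pos

theorem d_eq_a_mul (h : IsWeights g a' b' k a b d) : d = a * (k * b') := by
  rw [h.d_eq, h.a_eq]; ring

theorem d_eq_b_mul (h : IsWeights g a' b' k a b d) : d = b * (k * a') := by
  rw [h.d_eq, h.b_eq]; ring

/-- After division by `g`, coprimality forces `b' ∣ i`. Hence only `k + 1` monomials of weight `d`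
are free of `x₀`, and `topPoly` records all of them. -/
theorem mul_add_mul_eq_iff (h : IsWeights g a' b' k a b d) (i j : ℕ) :
    a * i + b * j = d ↔ ∃ m ≤ k, i = m * b' ∧ j = (k - m) * a' := by
  constructor
  · intro hij
    have h1 : a' * i + b' * j = k * (a' * b') := by
      refine Nat.eq_of_mul_eq_mul_left h.g_pos ?_
      rw [h.d_eq, h.a_eq, h.b_eq] at hij
      linear_combination hij
    have h2 : b' ∣ a' * i := by
      rw [Nat.dvd_add_iff_left (Nat.dvd_mul_right b' j), h1]
      exact Dvd.intro_left (k * a') (by ring)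
    obtain ⟨m, rfl⟩ := h.coprime.symm.dvd_of_dvd_mul_left h2
    have h3 : a' * m + j = k * a' := by
      refine Nat.eq_of_mul_eq_mul_left h.b'_pos ?_
      linear_combination h1
    have hm : m ≤ k := by
      refine Nat.le_of_mul_le_mul_left ?_ h.a'_pos
      rw [mul_comm a' k]
      omega
    refine ⟨m, hm, mul_comm _ _, ?_⟩
    rw [Nat.sub_mul, mul_comm m a']
    omega
  · rintro ⟨m, hm, rfl, rfl⟩
    obtain ⟨n, rfl⟩ := Nat.exists_eq_add_of_le hm
    rw [Nat.add_sub_cancel_left, h.d_eq, h.a_eq, h.b_eq]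
    ring

end IsWeights

/-! ### Dehomogenization and the bound for the zeros of a form -/

section Dehomogenize

variable {F : Type*} [Field F] {a b d : ℕ}

/-- `p(1, x₁, x₂)`, as a polynomial in `x₁` with coefficients in `F[x₂]`. -/
noncomputable def dehom (p : MvPolynomial (Fin 3) F) : F[X][X] :=
  MvPolynomial.aeval ![1, X, C X] p

theorem weight_three (e : Fin 3 →₀ ℕ) :
    Finsupp.weight (![1, a, b] : Fin 3 → ℕ) e = e 0 + a * e 1 + b * e 2 := by
  rw [Finsupp.weight_apply, Finsupp.sum_fintype _ _ (by simp), Fin.sum_univ_three]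
  simp [mul_comm]

theorem Sd_weight {p : MvPolynomial (Fin 3) F} (hp : p ∈ Sd F ![1, a, b] d) {e : Fin 3 →₀ ℕ}
    (he : p.coeff e ≠ 0) : e 0 + a * e 1 + b * e 2 = d := by
  rw [← weight_three]
  exact hp he

theorem coeff_coeff_dehom (p : MvPolynomial (Fin 3) F) (i j : ℕ) :
    ((dehom p).coeff i).coeff j =
      ∑ e ∈ p.support, if e 1 = i ∧ e 2 = j then p.coeff e else 0 := by
  rw [dehom, MvPolynomial.aeval_def, MvPolynomial.eval₂_eq']
  simp only [Fin.prod_univ_three, finsetSum_coeff]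
  refine Finset.sum_congr rfl fun e _ => ?_
  have h : (algebraMap F F[X][X]) (p.coeff e) * ((![1, X, C X] : Fin 3 → F[X][X]) 0 ^ e 0 *
      (![1, X, C X] : Fin 3 → F[X][X]) 1 ^ e 1 * (![1, X, C X] : Fin 3 → F[X][X]) 2 ^ e 2) =
      monomial (e 1) (monomial (e 2) (p.coeff e)) := by
    rw [← C_mul_X_pow_eq_monomial, ← C_mul_X_pow_eq_monomial]
    simp [Polynomial.algebraMap_apply]
    ring
  rw [h, coeff_monomial]
  split_ifs with h1 h2 h2
  · rw [coeff_monomial, if_pos h2.2]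
  · rw [coeff_monomial, if_neg (fun h => h2 ⟨h1, h⟩)]
  · exact absurd h2.1 h1
  · rfl

theorem wtLE_dehom {p : MvPolynomial (Fin 3) F} (hp : p ∈ Sd F ![1, a, b] d) :
    WtLE a b d (dehom p) := by
  intro i j hij
  rw [coeff_coeff_dehom] at hij
  obtain ⟨e, he, hne⟩ := Finset.exists_ne_zero_of_sum_ne_zero hij
  split_ifs at hne with h
  · have := Sd_weight hp (MvPolynomial.mem_support_iff.mp he)
    rw [← h.1, ← h.2]
    omega
  · exact absurd rfl hne

theorem coeff_coeff_dehom_eq {p : MvPolynomial (Fin 3) F} (hp : p ∈ Sd F ![1, a, b] d)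
    {e : Fin 3 →₀ ℕ} (he : e 0 + a * e 1 + b * e 2 = d) :
    ((dehom p).coeff (e 1)).coeff (e 2) = p.coeff e := by
  rw [coeff_coeff_dehom, Finset.sum_eq_single e]
  · simp
  · intro e' he' hne
    refine if_neg fun h => hne ?_
    have := Sd_weight hp (MvPolynomial.mem_support_iff.mp he')
    rw [h.1, h.2] at this
    ext i
    fin_cases i
    · change e' 0 = e 0
      omega
    · exact h.1
    · exact h.2
  · intro h
    simpa using h

theorem dehom_ne_zero {p : MvPolynomial (Fin 3) F} (hp : p ∈ Sd F ![1, a, b] d) (h0 : p ≠ 0) :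
    dehom p ≠ 0 := by
  obtain ⟨e, he⟩ := MvPolynomial.ne_zero_iff.mp h0
  intro h
  have := coeff_coeff_dehom_eq hp (Sd_weight hp he)
  rw [h] at this
  exact he (by simpa using this.symm)

theorem eval_map_dehom (p : MvPolynomial (Fin 3) F) (x u : F) :
    ((dehom p).map (evalRingHom u)).eval x = MvPolynomial.eval ![1, x, u] p := by
  have h : ((Polynomial.evalRingHom x).comp (Polynomial.mapRingHom (evalRingHom u))).comp
      (MvPolynomial.aeval ![1, X, C X] : MvPolynomial (Fin 3) F →ₐ[F] F[X][X]).toRingHom =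
      MvPolynomial.eval ![1, x, u] := by
    refine MvPolynomial.ringHom_ext (fun c => ?_) fun i => ?_
    · simp [Polynomial.algebraMap_apply]
    · fin_cases i <;> simp
  exact DFunLike.congr_fun h p

/-- Values of a form at infinity. -/
theorem eval_zero_eq_sum {g a' b' k : ℕ} (hw : IsWeights g a' b' k a b d)
    {p : MvPolynomial (Fin 3) F} (hp : p ∈ Sd F ![1, a, b] d) (y₁ y₂ : F) :
    MvPolynomial.eval ![0, y₁, y₂] p = ∑ m ∈ Finset.range (k + 1),
      (topPoly a' b' k (dehom p)).coeff m * (y₁ ^ (m * b') * y₂ ^ ((k - m) * a')) := by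
  classical
  rw [MvPolynomial.eval_eq']
  let E : ℕ → (Fin 3 →₀ ℕ) := fun m => Finsupp.equivFunOnFinite.symm ![0, m * b', (k - m) * a']
  have hE : ∀ m ≤ k, (E m) 0 + a * (E m) 1 + b * (E m) 2 = d := fun m hm => by
    change 0 + a * (m * b') + b * ((k - m) * a') = d
    rw [zero_add, hw.mul_add_mul_eq_iff]
    exact ⟨m, hm, rfl, rfl⟩
  symm
  refine Finset.sum_bij_ne_zero (fun m _ _ => E m) ?_ ?_ ?_ ?_
  · intro m hm hne
    have hm := Finset.mem_range_succ_iff.mp hm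
    rw [topPoly_coeff _ _ _ _ _ hm] at hne
    rw [MvPolynomial.mem_support_iff, ← coeff_coeff_dehom_eq hp (hE m hm)]
    exact left_ne_zero_of_mul hne
  · intro m _ _ n _ _ hmn
    have h1 : m * b' = n * b' := DFunLike.congr_fun hmn 1
    exact Nat.eq_of_mul_eq_mul_right hw.b'_pos h1
  · intro e he hne
    have he' := Sd_weight hp (MvPolynomial.mem_support_iff.mp he)
    have he0 : e 0 = 0 := by
      by_contra h
      rw [Fin.prod_univ_three] at hne
      simp [h] at hne
    obtain ⟨m, hm, h1, h2⟩ := (hw.mul_add_mul_eq_iff (e 1) (e 2)).mp (by omega)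
    have hEe : E m = e := by
      ext i
      fin_cases i
      · exact he0.symm
      · exact h1.symm
      · exact h2.symm
    refine ⟨m, Finset.mem_range_succ_iff.mpr hm, ?_, hEe⟩
    rw [topPoly_coeff _ _ _ _ _ hm, ← h1, ← h2, coeff_coeff_dehom_eq hp he']
    rw [Fin.prod_univ_three] at hne
    simpa [he0] using hne
  · intro m hm _
    have hm := Finset.mem_range_succ_iff.mp hm
    rw [topPoly_coeff _ _ _ _ _ hm, ← coeff_coeff_dehom_eq hp (hE m hm), Fin.prod_univ_three]
    simp [E]

/-- Each monomial free of `x₀` is `(y₁ ^ b') ^ m * (y₂ ^ a') ^ (k - m)`, which becomes `z ^ m` times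
the common factor `y₂ ^ (k a')`. -/
theorem eval_zero_eq {g a' b' k : ℕ} (hw : IsWeights g a' b' k a b d)
    {p : MvPolynomial (Fin 3) F} (hp : p ∈ Sd F ![1, a, b] d) {y₁ y₂ z : F}
    (hz : y₁ ^ b' = z * y₂ ^ a') :
    MvPolynomial.eval ![0, y₁, y₂] p =
      y₂ ^ (k * a') * (topPoly a' b' k (dehom p)).eval z := by
  rw [eval_zero_eq_sum hw hp, eval_eq_sum_range' (n := k + 1)
    (Nat.lt_succ_of_le (natDegree_topPoly_le a' b' k _)), Finset.mul_sum]
  refine Finset.sum_congr rfl fun m hm => ?_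
  obtain ⟨n, rfl⟩ := Nat.exists_eq_add_of_le (Finset.mem_range_succ_iff.mp hm)
  rw [mul_comm m b', pow_mul, hz, Nat.add_sub_cancel_left, mul_pow, add_mul, pow_add,
    mul_comm m a', pow_mul]
  ring

theorem eval_zero_one_zero {g a' b' k : ℕ} (hw : IsWeights g a' b' k a b d)
    {p : MvPolynomial (Fin 3) F} (hp : p ∈ Sd F ![1, a, b] d) :
    MvPolynomial.eval ![0, 1, 0] p = ((dehom p).coeff (k * b')).coeff 0 := by
  rw [eval_zero_eq_sum hw hp, Finset.sum_eq_single_of_mem k (Finset.self_mem_range_succ k)]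
  · rw [topPoly_coeff _ _ _ _ _ le_rfl]
    simp
  · intro m hm hmk
    have : 0 < (k - m) * a' :=
      Nat.mul_pos (by have := Finset.mem_range.mp hm; omega) hw.a'_pos
    rw [zero_pow this.ne', mul_zero, mul_zero]

theorem natDegree_dehom_le {g a' b' k : ℕ} (hw : IsWeights g a' b' k a b d)
    {p : MvPolynomial (Fin 3) F} (hp : p ∈ Sd F ![1, a, b] d) :
    (dehom p).natDegree ≤ k * b' := by
  by_cases h0 : dehom p = 0
  · simp [h0]
  · have h1 := (wtLE_dehom hp).natDegree_coeff_le (leadingCoeff_ne_zero.mpr h0)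
    refine Nat.le_of_mul_le_mul_left ?_ hw.a_pos
    rw [← hw.d_eq_a_mul]
    omega

/-- The weight of `x₁ ^ (k b')` is already `d`, which leaves no room for `x₂`. -/
theorem coeff_dehom_eq_C {g a' b' k : ℕ} (hw : IsWeights g a' b' k a b d)
    {p : MvPolynomial (Fin 3) F} (hp : p ∈ Sd F ![1, a, b] d) :
    (dehom p).coeff (k * b') = C (((dehom p).coeff (k * b')).coeff 0) := by
  by_cases hl : (dehom p).coeff (k * b') = 0
  · simp [hl]
  · have h1 := (wtLE_dehom hp).natDegree_coeff_le hl
    rw [← hw.d_eq_a_mul] at h1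
    have h3 : b * ((dehom p).coeff (k * b')).natDegree = 0 := by omega
    exact eq_C_of_natDegree_eq_zero ((Nat.mul_eq_zero.mp h3).resolve_left hw.b_pos.ne')

theorem natDegree_dehom_lt {g a' b' k : ℕ} (hw : IsWeights g a' b' k a b d)
    {p : MvPolynomial (Fin 3) F} (hp : p ∈ Sd F ![1, a, b] d) (h0 : p ≠ 0)
    (hc : ((dehom p).coeff (k * b')).coeff 0 = 0) : (dehom p).natDegree < k * b' := by
  refine lt_of_le_of_ne (natDegree_dehom_le hw hp) fun h => ?_
  have hl := leadingCoeff_ne_zero.mpr (dehom_ne_zero hp h0)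
  exact hl (by rw [leadingCoeff, h, coeff_dehom_eq_C hw hp, hc, C_0])

theorem aeval_mem_Sd {σ : Type*} {m : ℕ} {w : Fin (m + 1) → ℕ} {d : ℕ}
    {p : MvPolynomial (Fin (m + 1)) F} (hp : p ∈ Sd F w d) {v : σ → ℕ}
    {f : Fin (m + 1) → MvPolynomial σ F}
    (hf : ∀ i, (f i).IsWeightedHomogeneous v (w i)) :
    (MvPolynomial.aeval f p).IsWeightedHomogeneous v d := by
  rw [MvPolynomial.aeval_def, MvPolynomial.eval₂_eq']
  refine MvPolynomial.IsWeightedHomogeneous.sum _ _ _ fun e he => ?_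
  have he : Finsupp.weight w e = d := hp (MvPolynomial.mem_support_iff.mp he)
  rw [Finsupp.weight_apply, Finsupp.sum_fintype _ _ (by simp)] at he
  rw [← zero_add d, ← he]
  exact (MvPolynomial.isWeightedHomogeneous_C v _).mul
    (MvPolynomial.IsWeightedHomogeneous.prod _ _ _ fun i _ => (hf i).pow _)

variable [Fintype F]

/-- The bound for the zeros of a form, in the affine plane and at infinity. -/
theorem zeros_le {g a' b' k : ℕ} (hw : IsWeights g a' b' k a b d) (hab : a ≤ b)
    (hdq : d ≤ Fintype.card F) {p : MvPolynomial (Fin 3) F} (hp : p ∈ Sd F ![1, a, b] d)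
    (h0 : p ≠ 0) :
    affZeros (dehom p) + Nat.card {z : F // (topPoly a' b' k (dehom p)).eval z = 0} +
      (open Classical in if ((dehom p).coeff (k * b')).coeff 0 = 0 then 1 else 0) ≤
        k * b' * Fintype.card F + 1 := by
  have hDq : k * b' ≤ Fintype.card F :=
    (Nat.le_mul_of_pos_left _ hw.a_pos).trans (hw.d_eq_a_mul ▸ hdq)
  have hlt : ∀ r ∈ Sd F ![1, a, b] d, r ≠ 0 → ((dehom r).coeff (k * b')).coeff 0 = 0 →
      affZeros (dehom r) + Nat.card {z : F // (topPoly a' b' k (dehom r)).eval z = 0} + 1 ≤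
        k * b' * Fintype.card F + 1 := fun r hr hr0 hc =>
    zeros_le_of_natDegree_lt hw.b'_pos hab hw.a_pos hw.d_eq_a_mul hDq
      (fun i j => (hw.mul_add_mul_eq_iff i j).mp) (dehom_ne_zero hr hr0) (wtLE_dehom hr)
      (natDegree_dehom_lt hw hr hr0 hc)
  split_ifs with hc
  · exact hlt p hp h0 hc
  rw [add_zero]
  rcases hab.lt_or_eq with hab | rfl
  · refine zeros_le_of_coeff_ne_zero hw.b'_pos hab hw.d_eq_a_mul rfl ?_ (wtLE_dehom hp)
      (natDegree_dehom_le hw hp) hw.a'_pos hc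
    refine le_trans ?_ hdq
    rw [hw.d_eq_b_mul, ← mul_assoc]
    exact Nat.le_mul_of_pos_right _ hw.a'_pos
  have ha'b' : a' = b' := Nat.eq_of_mul_eq_mul_left hw.g_pos (hw.a_eq.symm.trans hw.b_eq)
  subst ha'b'
  have ha1 : a' = 1 := by simpa using hw.coprime
  subst ha1
  -- Now `a' = b' = 1`, so linear substitutions in `x₁`, `x₂` preserve weights. The one below
  -- carries `(0 : 1 : 0)` to the zero `(0 : z₀ : 1)` of `p`.
  by_cases hz : ∃ z₀, (topPoly 1 1 k (dehom p)).eval z₀ = 0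
  · obtain ⟨z₀, hz₀⟩ := hz
    set r : MvPolynomial (Fin 3) F := MvPolynomial.aeval
      ![MvPolynomial.X 0, MvPolynomial.C z₀ * MvPolynomial.X 1 + MvPolynomial.X 2,
        MvPolynomial.X 1] p with hr
    have hrmem : r ∈ Sd F ![1, a, a] d := by
      have hX := fun i => MvPolynomial.isWeightedHomogeneous_X F (![1, a, a] : Fin 3 → ℕ) i
      refine aeval_mem_Sd hp fun i => ?_
      fin_cases i
      · exact hX 0
      · have h1 := (MvPolynomial.isWeightedHomogeneous_C (![1, a, a] : Fin 3 → ℕ) z₀).mul (hX 1)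
        rw [zero_add] at h1
        exact h1.add (hX 2)
      · exact hX 1
    have hr0 : r ≠ 0 := by
      have hinv : (MvPolynomial.aeval ![MvPolynomial.X 0, MvPolynomial.X 2,
          MvPolynomial.X 1 - MvPolynomial.C z₀ * MvPolynomial.X 2] :
            MvPolynomial (Fin 3) F →ₐ[F] MvPolynomial (Fin 3) F).comp (MvPolynomial.aeval
          ![MvPolynomial.X 0, MvPolynomial.C z₀ * MvPolynomial.X 1 + MvPolynomial.X 2,
            MvPolynomial.X 1]) = AlgHom.id F _ := by
        refine MvPolynomial.algHom_ext fun i => ?_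
        fin_cases i <;> simp [MvPolynomial.algebraMap_eq]
      intro h
      apply h0
      have h1 := DFunLike.congr_fun hinv p
      rw [AlgHom.comp_apply, ← hr, h, map_zero] at h1
      exact h1.symm
    have hreval : ∀ x₀ x₁ x₂ : F, MvPolynomial.eval ![x₀, x₁, x₂] r =
        MvPolynomial.eval ![x₀, z₀ * x₁ + x₂, x₁] p := by
      intro x₀ x₁ x₂
      have h1 : (MvPolynomial.eval ![x₀, x₁, x₂]).comp (MvPolynomial.aeval
          ![MvPolynomial.X 0, MvPolynomial.C z₀ * MvPolynomial.X 1 + MvPolynomial.X 2,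
            MvPolynomial.X 1] : MvPolynomial (Fin 3) F →ₐ[F] MvPolynomial (Fin 3) F).toRingHom =
          MvPolynomial.eval ![x₀, z₀ * x₁ + x₂, x₁] := by
        refine MvPolynomial.ringHom_ext (fun c => by simp) fun i => ?_
        fin_cases i <;> simp
      exact DFunLike.congr_fun h1 p
    have hrc : ((dehom r).coeff (k * 1)).coeff 0 = 0 := by
      rw [← eval_zero_one_zero hw hrmem, hreval]
      have h1 := eval_zero_eq hw hp (y₁ := z₀ * 1 + 0) (y₂ := 1) (z := z₀) (by simp)
      rw [h1, hz₀, mul_zero]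
    have haff : affZeros (dehom p) = affZeros (dehom r) := by
      unfold affZeros
      simp only [eval_map_dehom, hreval]
      exact Nat.card_congr
        { toFun := fun v => ⟨(v.1.2, v.1.1 - z₀ * v.1.2), by
            have := v.2
            simpa using this⟩
          invFun := fun v => ⟨(z₀ * v.1.1 + v.1.2, v.1.1), v.2⟩
          left_inv := fun v => by ext <;> simp
          right_inv := fun v => by ext <;> simp }
    -- The root `z₀` moves to `(0 : 1 : 0)` and is sent to `none`; any other root `w` becomes `1 /
    -- (w - z₀)`.
    have htop : Nat.card {z : F // (topPoly 1 1 k (dehom p)).eval z = 0} ≤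
        Nat.card {z : F // (topPoly 1 1 k (dehom r)).eval z = 0} + 1 := by
      classical
      rw [← Finite.card_option]
      have hmap : ∀ w : {z : F // (topPoly 1 1 k (dehom p)).eval z = 0}, w.1 ≠ z₀ →
          (topPoly 1 1 k (dehom r)).eval (w.1 - z₀)⁻¹ = 0 := by
        intro w hwz
        have hne : w.1 - z₀ ≠ 0 := sub_ne_zero.mpr hwz
        have h1 := eval_zero_eq hw hrmem (y₁ := (w.1 - z₀)⁻¹) (y₂ := 1) (z := (w.1 - z₀)⁻¹)
          (by simp)
        rw [one_pow, one_mul] at h1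
        rw [← h1, hreval]
        have h2 := eval_zero_eq hw hp (y₁ := z₀ * (w.1 - z₀)⁻¹ + 1) (y₂ := (w.1 - z₀)⁻¹)
          (z := w.1) (by field_simp; ring)
        rw [h2, w.2, mul_zero]
      refine Nat.card_le_card_of_injective
        (fun w => if hwz : w.1 = z₀ then none else some ⟨_, hmap w hwz⟩) fun w w' hww => ?_
      dsimp only at hww
      split_ifs at hww with h1 h2 h2
      · exact Subtype.ext (h1.trans h2.symm)
      · exact Subtype.ext (by simpa using hww)
    rw [haff]
    have := hlt r hrmem hr0 hrc
    omega
  · push Not at hz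
    have : IsEmpty {z : F // (topPoly 1 1 k (dehom p)).eval z = 0} := ⟨fun z => hz z.1 z.2⟩
    rw [Nat.card_of_isEmpty, add_zero, affZeros_eq_sum]
    refine (Finset.sum_le_card_nsmul _ _ (k * 1) fun u _ => ?_).trans ?_
    · refine (card_zeros_le fun h => hc ?_).trans
        (natDegree_map_le.trans (natDegree_dehom_le hw hp))
      have h1 := congrArg (fun f => f.coeff (k * 1)) h
      rw [coeff_map, coeff_dehom_eq_C hw hp] at h1
      simpa using h1
    · rw [Finset.card_univ, smul_eq_mul, mul_comm]
      omega

end Dehomogenize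

/-! ### Rational points and their coordinates -/

/-- The invariant `y₁ ^ b' / y₂ ^ a'` separates the points at infinity with `y₂ ≠ 0`. A scalar that
matches the second coordinates leaves an error `ω` with `ω ^ b' = 1` in the first, and Bézout's
identity supplies a correction that leaves the second untouched. -/
theorem exists_scaling {K : Type*} [Field K] [IsAlgClosed K] {g a' b' : ℕ} (hg : 0 < g)
    (hb : 0 < b') (hc : Nat.Coprime a' b') {s₁ s₂ y₁ y₂ : K} (hs₂ : s₂ ≠ 0)
    (hy₂ : y₂ ≠ 0) (h : s₁ ^ b' * y₂ ^ a' = y₁ ^ b' * s₂ ^ a') :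
    ∃ t : K, t ≠ 0 ∧ y₁ = t ^ (g * a') * s₁ ∧ y₂ = t ^ (g * b') * s₂ := by
  obtain ⟨t₀, ht₀⟩ := IsAlgClosed.exists_pow_nat_eq (y₂ / s₂) (Nat.mul_pos hg hb)
  have ht₀0 : t₀ ≠ 0 := by
    rintro rfl
    rw [zero_pow (Nat.mul_pos hg hb).ne'] at ht₀
    exact div_ne_zero hy₂ hs₂ ht₀.symm
  by_cases hs₁ : s₁ = 0
  · subst hs₁
    refine ⟨t₀, ht₀0, ?_, by rw [ht₀, div_mul_cancel₀ _ hs₂]⟩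
    rw [zero_pow hb.ne', zero_mul] at h
    have := (mul_eq_zero.mp h.symm).resolve_right (pow_ne_zero _ hs₂)
    rw [mul_zero]
    exact eq_zero_of_pow_eq_zero this
  have hy₁ : y₁ ≠ 0 := by
    rintro rfl
    rw [zero_pow hb.ne', zero_mul] at h
    exact mul_ne_zero (pow_ne_zero _ hs₁) (pow_ne_zero _ hy₂) h
  set ω := y₁ / (t₀ ^ (g * a') * s₁) with hω
  have hω0 : ω ≠ 0 := div_ne_zero hy₁ (mul_ne_zero (pow_ne_zero _ ht₀0) hs₁)
  have hωb : ω ^ b' = 1 := by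
    have h1 : (t₀ ^ (g * a')) ^ b' = (y₂ / s₂) ^ a' := by
      rw [← ht₀, ← pow_mul, ← pow_mul]
      congr 1
      ring
    rw [hω, div_pow, mul_pow, h1, div_pow]
    field_simp
    linear_combination -h
  have hbez : (1 : ℤ) = a' * Nat.gcdA a' b' + b' * Nat.gcdB a' b' := by
    have := Nat.gcd_eq_gcd_ab a' b'
    rwa [hc] at this
  -- With `a' α + b' β = 1` and `t₁ ^ g = ω ^ α`, one gets `t₁ ^ (g a') = ω` and `t₁ ^ (g b') = 1`.
  obtain ⟨t₁, ht₁⟩ := IsAlgClosed.exists_pow_nat_eq (ω ^ Nat.gcdA a' b') hg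
  have h1 : t₁ ^ (g * a') = ω := by
    rw [pow_mul, ht₁, ← zpow_natCast, ← zpow_mul,
      show Nat.gcdA a' b' * (a' : ℤ) = 1 - b' * Nat.gcdB a' b' by linear_combination -hbez,
      zpow_sub₀ hω0, zpow_mul, zpow_natCast, hωb, one_zpow, zpow_one, div_one]
  have h2 : t₁ ^ (g * b') = 1 := by
    rw [pow_mul, ht₁, ← zpow_natCast, zpow_comm, zpow_natCast, hωb, one_zpow]
  refine ⟨t₀ * t₁, mul_ne_zero ht₀0 fun h0 => ?_, ?_, ?_⟩
  · rw [h0, zero_pow (Nat.mul_pos hg hb).ne'] at h2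
    exact zero_ne_one h2
  · rw [mul_pow, h1, hω]
    have := pow_ne_zero (g * a') ht₀0
    field_simp
  · rw [mul_pow, h2, mul_one, ht₀, div_mul_cancel₀ _ hs₂]

section Points

variable {F : Type*} [Field F]

theorem exists_coords {a' b' : ℕ} (hb : 0 < b') (hc : Nat.Coprime a' b') (z : F) :
    ∃ y₁ y₂ : F, y₂ ≠ 0 ∧ y₁ ^ b' = z * y₂ ^ a' := by
  by_cases hz : z = 0
  · exact ⟨0, 1, one_ne_zero, by rw [hz, zero_pow hb.ne', zero_mul]⟩
  · have hbez : (1 : ℤ) = a' * Nat.gcdA a' b' + b' * Nat.gcdB a' b' := by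
      have := Nat.gcd_eq_gcd_ab a' b'
      rwa [hc] at this
    -- With `a' α + b' β = 1`, take `y₁ = z ^ β` and `y₂ = z ^ (-α)`; then `z ^ (b' β) = z * z ^
    -- (-a' α)`.
    refine ⟨z ^ Nat.gcdB a' b', z ^ (-Nat.gcdA a' b'), zpow_ne_zero _ hz, ?_⟩
    rw [← zpow_natCast, ← zpow_mul, ← zpow_natCast, ← zpow_mul, ← zpow_one_add₀ hz]
    congr 1
    linear_combination -hbez

/-- Coordinates of the rational points of `ℙ(1, a, b)`: an affine plane, the point `(0 : 1 : 0)`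
and a line. -/
def coordVec (y₁ y₂ : F → F) : (F × F) ⊕ Option F → Fin 3 → F
  | .inl v => ![1, v.1, v.2]
  | .inr none => ![0, 1, 0]
  | .inr (some z) => ![0, y₁ z, y₂ z]

theorem coordVec_ne_zero {y₁ y₂ : F → F} (hy₂ : ∀ z, y₂ z ≠ 0) (s : (F × F) ⊕ Option F) :
    coordVec y₁ y₂ s ≠ 0 := by
  intro h
  rcases s with v | _ | z
  · exact one_ne_zero (congrFun h 0)
  · exact one_ne_zero (congrFun h 1)
  · exact hy₂ z (congrFun h 2)

variable [Fintype F] {m : ℕ}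

/-- The rational point with given coordinates in `F`. -/
noncomputable def ratPt (a : Fin (m + 1) → ℕ) (v : Fin (m + 1) → F) (hv : v ≠ 0) :
    RatPoint F a :=
  ⟨Quotient.mk (setoid F a) ⟨fun i => algebraMap F (AlgebraicClosure F) (v i), fun h =>
    hv (funext fun i => (algebraMap F (AlgebraicClosure F)).injective
      ((congrFun h i).trans (map_zero _).symm))⟩, by
    refine congrArg (Quotient.mk (setoid F a)) (Subtype.ext (funext fun i => ?_))
    simp only [frobVec]
    rw [← map_pow, FiniteField.pow_card]⟩

theorem ratPt_eq_iff {a : Fin (m + 1) → ℕ} {v w : Fin (m + 1) → F} (hv : v ≠ 0) (hw : w ≠ 0) :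
    ratPt a v hv = ratPt a w hw ↔ ∃ t : AlgebraicClosure F, t ≠ 0 ∧
      ∀ i, algebraMap F (AlgebraicClosure F) (w i) =
        t ^ a i * algebraMap F (AlgebraicClosure F) (v i) :=
  ⟨fun h => Quotient.exact (congrArg Subtype.val h),
    fun h => Subtype.ext (Quotient.sound h)⟩

theorem exists_eq_ratPt {a : Fin (m + 1) → ℕ} (P : RatPoint F a) :
    ∃ (v : Fin (m + 1) → F) (hv : v ≠ 0), P = ratPt a v hv := by
  obtain ⟨v, hv, h⟩ := exists_rep a P
  refine ⟨v, ?_, Subtype.ext h⟩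
  rintro rfl
  exact hv (funext fun i => map_zero _)

theorem evalMap_ratPt_eq_zero_iff {a : Fin (m + 1) → ℕ} {d : ℕ} (hd : ∀ i, a i ∣ d)
    (p : Sd F a d) {v : Fin (m + 1) → F} (hv : v ≠ 0) :
    evalMap a d hd p (ratPt a v hv) = 0 ↔ MvPolynomial.eval v p.1 = 0 := by
  rw [← map_eq_zero (algebraMap F (AlgebraicClosure F)), algebraMap_evalMap]
  change normEval a d p.1 _ = 0 ↔ _
  rw [normEval, div_eq_zero_iff, or_iff_left (pow_ne_zero _ (lead_ne_zero _))]
  change MvPolynomial.aeval (algebraMap F (AlgebraicClosure F) ∘ v) p.1 = 0 ↔ _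
  rw [MvPolynomial.aeval_algebraMap_apply, map_eq_zero]
  rfl

theorem bijective_ratPt_coordVec {g a' b' k a b d : ℕ} (hw : IsWeights g a' b' k a b d)
    {y₁ y₂ : F → F} (hy₂ : ∀ z, y₂ z ≠ 0) (hy : ∀ z, y₁ z ^ b' = z * y₂ z ^ a') :
    Function.Bijective fun s =>
      ratPt ![1, a, b] (coordVec y₁ y₂ s) (coordVec_ne_zero hy₂ s) := by
  have hinj := (algebraMap F (AlgebraicClosure F)).injective
  constructor
  · intro s s' h
    obtain ⟨t, ht0, ht⟩ := (ratPt_eq_iff _ _).mp h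
    have h0 := ht 0
    have h1 := ht 1
    have h2 := ht 2
    rcases s with ⟨x, u⟩ | _ | z <;> rcases s' with ⟨x', u'⟩ | _ | z' <;>
      simp [coordVec, ht0, ht0.symm, hy₂] at h0 h1 h2
    · subst h0
      simp at h1 h2
      rw [h1, h2]
    · rfl
    · have hz : z' = z := by
        have hne : (algebraMap F (AlgebraicClosure F)) (y₂ z') ^ a' ≠ 0 :=
          pow_ne_zero _ (by simpa using hy₂ z')
        have e1 := congrArg (algebraMap F (AlgebraicClosure F)) (hy z')
        have e2 := congrArg (algebraMap F (AlgebraicClosure F)) (hy z)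
        simp only [map_mul, map_pow] at e1 e2
        refine hinj (mul_right_cancel₀ hne ?_)
        rw [← e1, h1, h2, mul_pow, e2, mul_pow, hw.a_eq, hw.b_eq, ← pow_mul, ← pow_mul,
          show g * b' * a' = g * a' * b' by ring]
        ring
      rw [hz]
  · intro P
    obtain ⟨v, hv, rfl⟩ := exists_eq_ratPt P
    by_cases h0 : v 0 = 0
    · by_cases h2 : v 2 = 0
      · have h1 : v 1 ≠ 0 := fun h1 => hv (by ext i; fin_cases i <;> assumption)
        refine ⟨.inr none, (ratPt_eq_iff _ _).mpr ?_⟩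
        obtain ⟨t, ht⟩ := IsAlgClosed.exists_pow_nat_eq
          (algebraMap F (AlgebraicClosure F) (v 1)) hw.a_pos
        refine ⟨t, ?_, fun i => ?_⟩
        · rintro rfl
          rw [zero_pow hw.a_pos.ne'] at ht
          exact h1 (hinj (ht.symm.trans (map_zero _).symm))
        · fin_cases i <;> simp [coordVec, h0, h2, ht]
      -- The representative chosen for this invariant has the same `z`, so `exists_scaling` links it
      -- to `v`.
      · set z := v 1 ^ b' / v 2 ^ a' with hz
        refine ⟨.inr (some z), (ratPt_eq_iff _ _).mpr ?_⟩
        have hF : y₁ z ^ b' * v 2 ^ a' = v 1 ^ b' * y₂ z ^ a' := by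
          rw [hy, hz]
          have := pow_ne_zero a' h2
          field_simp
        have hK := congrArg (algebraMap F (AlgebraicClosure F)) hF
        simp only [map_mul, map_pow] at hK
        obtain ⟨t, ht0, ht1, ht2⟩ := exists_scaling hw.g_pos hw.b'_pos hw.coprime
          (by simpa using hy₂ z) (by simpa using h2) hK
        refine ⟨t, ht0, fun i => ?_⟩
        fin_cases i
        · simp [coordVec, h0]
        · simpa [coordVec, hw.a_eq] using ht1
        · simpa [coordVec, hw.b_eq] using ht2
    · refine ⟨.inl (v 1 / v 0 ^ a, v 2 / v 0 ^ b), (ratPt_eq_iff _ _).mpr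
        ⟨algebraMap F _ (v 0), by simpa using h0, fun i => ?_⟩⟩
      rw [← map_pow, ← map_mul]
      congr 1
      fin_cases i <;> simp [coordVec] <;> field_simp

/-- The number of rational points of `ℙ(1, a, b)`. -/
theorem card_ratPoint {g a' b' k a b d : ℕ} (hw : IsWeights g a' b' k a b d) :
    Fintype.card (RatPoint F ![1, a, b]) = Fintype.card F ^ 2 + Fintype.card F + 1 := by
  choose y₁ y₂ hy₂ hy using exists_coords (F := F) hw.b'_pos hw.coprime
  rw [← Fintype.card_congr (Equiv.ofBijective _ (bijective_ratPt_coordVec hw hy₂ hy))]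
  simp only [Fintype.card_sum, Fintype.card_prod, Fintype.card_option]
  ring

/-- The weight of a codeword, through the zeros in the affine plane and at infinity. -/
theorem hammingNorm_evalMap_add {g a' b' k a b d : ℕ} (hw : IsWeights g a' b' k a b d)
    (hd : ∀ i, (![1, a, b] : Fin 3 → ℕ) i ∣ d) (p : Sd F ![1, a, b] d) :
    (open Classical in hammingNorm (evalMap ![1, a, b] d hd p)) +
      (affZeros (dehom p.1) + Nat.card {z : F // (topPoly a' b' k (dehom p.1)).eval z = 0} +
        (open Classical in if ((dehom p.1).coeff (k * b')).coeff 0 = 0 then 1 else 0)) =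
      Fintype.card F ^ 2 + Fintype.card F + 1 := by
  classical
  choose y₁ y₂ hy₂ hy using exists_coords (F := F) hw.b'_pos hw.coprime
  have hbij := bijective_ratPt_coordVec hw hy₂ hy
  rw [← card_ratPoint (F := F) hw]
  have hz : Nat.card {P // evalMap ![1, a, b] d hd p P = 0} = affZeros (dehom p.1) +
      Nat.card {z : F // (topPoly a' b' k (dehom p.1)).eval z = 0} +
        (if ((dehom p.1).coeff (k * b')).coeff 0 = 0 then 1 else 0) := by
    rw [← Nat.card_congr ((Equiv.ofBijective _ hbij).subtypeEquiv
      (p := fun s => MvPolynomial.eval (coordVec y₁ y₂ s) p.1 = 0)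
      (fun s => (evalMap_ratPt_eq_zero_iff hd p (coordVec_ne_zero hy₂ s)).symm))]
    rw [Nat.card_eq_fintype_card, Fintype.card_subtype, Finset.card_filter, Fintype.sum_sum_type,
      Fintype.sum_option, ← Finset.card_filter, ← Finset.card_filter, ← Fintype.card_subtype,
      ← Fintype.card_subtype, ← Nat.card_eq_fintype_card, ← Nat.card_eq_fintype_card, affZeros,
      add_assoc, add_comm (Nat.card {z : F // _})]
    simp only [coordVec, eval_map_dehom, eval_zero_one_zero hw p.2,
      eval_zero_eq hw p.2 (hy _), mul_eq_zero, pow_ne_zero _ (hy₂ _), false_or]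
  rw [← hz, Nat.card_eq_fintype_card, Fintype.card_subtype, ← Finset.card_univ,
    ← Finset.card_filter_add_card_filter_not (s := Finset.univ)
      (fun P => evalMap ![1, a, b] d hd p P = 0), add_comm]
  rfl

end Points

/-! ### Dimension of the space of forms -/

section Dimension

variable {g a' b' k a b d : ℕ}

/-- The exponents `(i, j)` with `a i + b j ≤ d`. -/
def latticePoints (a b d D E : ℕ) : Finset (ℕ × ℕ) :=
  (Finset.range (D + 1) ×ˢ Finset.range (E + 1)).filter fun v => a * v.1 + b * v.2 ≤ d

/-- The point reflection of the rectangle exchanges the two sides of the diagonal `a i + b j = d`.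
Together they cover the rectangle, and they overlap in the `k + 1` points of the diagonal. -/
theorem two_mul_card_latticePoints (hw : IsWeights g a' b' k a b d) :
    2 * (latticePoints a b d (k * b') (k * a')).card =
      (k * b' + 1) * (k * a' + 1) + (k + 1) := by
  set R := Finset.range (k * b' + 1) ×ˢ Finset.range (k * a' + 1) with hR
  have hmem : ∀ v, v ∈ R ↔ v.1 ≤ k * b' ∧ v.2 ≤ k * a' := fun v => by
    rw [hR, Finset.mem_product, Finset.mem_range_succ_iff, Finset.mem_range_succ_iff]
  have hrefl : (R.filter fun v => a * v.1 + b * v.2 ≤ d).card =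
      (R.filter fun v => d ≤ a * v.1 + b * v.2).card := by
    have key : ∀ v ∈ R, a * (k * b' - v.1) + b * (k * a' - v.2) + (a * v.1 + b * v.2) =
        2 * d := fun v hv => by
      obtain ⟨h1, h2⟩ := (hmem v).mp hv
      obtain ⟨s, hs⟩ := Nat.exists_eq_add_of_le h1
      obtain ⟨t, ht⟩ := Nat.exists_eq_add_of_le h2
      rw [two_mul]
      nth_rewrite 1 [hw.d_eq_a_mul]
      rw [hw.d_eq_b_mul, hs, ht, Nat.add_sub_cancel_left, Nat.add_sub_cancel_left]
      ring
    refine Finset.card_nbij' (fun v => (k * b' - v.1, k * a' - v.2))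
      (fun v => (k * b' - v.1, k * a' - v.2)) ?_ ?_ ?_ ?_
    · intro v hv
      obtain ⟨hv, hle⟩ := Finset.mem_filter.mp hv
      have := key v hv
      exact Finset.mem_filter.mpr ⟨(hmem _).mpr ⟨Nat.sub_le _ _, Nat.sub_le _ _⟩, by
        dsimp only; omega⟩
    · intro v hv
      obtain ⟨hv, hle⟩ := Finset.mem_filter.mp hv
      have := key v hv
      exact Finset.mem_filter.mpr ⟨(hmem _).mpr ⟨Nat.sub_le _ _, Nat.sub_le _ _⟩, by
        dsimp only; omega⟩
    · intro v hv
      obtain ⟨h1, h2⟩ := (hmem v).mp (Finset.mem_filter.mp hv).1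
      exact Prod.ext (Nat.sub_sub_self h1) (Nat.sub_sub_self h2)
    · intro v hv
      obtain ⟨h1, h2⟩ := (hmem v).mp (Finset.mem_filter.mp hv).1
      exact Prod.ext (Nat.sub_sub_self h1) (Nat.sub_sub_self h2)
  have heq : (R.filter fun v => a * v.1 + b * v.2 = d).card = k + 1 := by
    rw [← Finset.card_range (k + 1)]
    symm
    refine Finset.card_bij (fun m _ => (m * b', (k - m) * a')) ?_ ?_ ?_
    · intro m hm
      have hm := Finset.mem_range_succ_iff.mp hm
      exact Finset.mem_filter.mpr ⟨(hmem _).mpr ⟨Nat.mul_le_mul_right _ hm,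
        Nat.mul_le_mul_right _ (Nat.sub_le _ _)⟩,
        (hw.mul_add_mul_eq_iff _ _).mpr ⟨m, hm, rfl, rfl⟩⟩
    · intro m _ n _ h
      exact Nat.eq_of_mul_eq_mul_right hw.b'_pos (congrArg Prod.fst h)
    · intro v hv
      obtain ⟨m, hm, h1, h2⟩ := (hw.mul_add_mul_eq_iff _ _).mp (Finset.mem_filter.mp hv).2
      exact ⟨m, Finset.mem_range_succ_iff.mpr hm, (Prod.ext h1 h2).symm⟩
  have hcard : R.card = (k * b' + 1) * (k * a' + 1) := by
    rw [hR, Finset.card_product, Finset.card_range, Finset.card_range]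
  have hsplit := Finset.card_union_add_card_inter
    (R.filter fun v => a * v.1 + b * v.2 ≤ d) (R.filter fun v => d ≤ a * v.1 + b * v.2)
  rw [← Finset.filter_or, ← Finset.filter_and, Finset.filter_true_of_mem
    (fun v _ => Nat.le_total _ _), ← hrefl] at hsplit
  simp only [← le_antisymm_iff] at hsplit
  rw [heq, hcard] at hsplit
  rw [latticePoints, two_mul]
  exact hsplit.symm

/-- Monomials form a basis, and the exponent of `x₀`, which has weight `1`, is determined by the
other two. -/
theorem finrank_Sd {F : Type*} [Field F] (hw : IsWeights g a' b' k a b d) :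
    Module.finrank F (Sd F ![1, a, b] d) = (latticePoints a b d (k * b') (k * a')).card := by
  have hmem : ∀ v, v ∈ latticePoints a b d (k * b') (k * a') ↔ a * v.1 + b * v.2 ≤ d := by
    intro v
    rw [latticePoints, Finset.mem_filter, and_iff_right_of_imp]
    intro h
    rw [Finset.mem_product, Finset.mem_range_succ_iff, Finset.mem_range_succ_iff]
    constructor
    · refine Nat.le_of_mul_le_mul_left ?_ hw.a_pos
      rw [← hw.d_eq_a_mul]
      omega
    · refine Nat.le_of_mul_le_mul_left ?_ hw.b_pos
      rw [← hw.d_eq_b_mul]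
      omega
  let e : {e : Fin 3 →₀ ℕ | Finsupp.weight (![1, a, b] : Fin 3 → ℕ) e = d} ≃
      latticePoints a b d (k * b') (k * a') :=
    { toFun := fun e => ⟨(e.1 1, e.1 2), by
        have := e.2
        rw [Set.mem_ofPred_eq, weight_three] at this
        rw [hmem]
        dsimp only
        omega⟩
      invFun := fun v => ⟨Finsupp.equivFunOnFinite.symm
          ![d - (a * v.1.1 + b * v.1.2), v.1.1, v.1.2], by
        have := (hmem _).mp v.2
        rw [Set.mem_ofPred_eq, weight_three]
        change d - (a * v.1.1 + b * v.1.2) + a * v.1.1 + b * v.1.2 = d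
        omega⟩
      left_inv := fun e => by
        have := e.2
        rw [Set.mem_ofPred_eq, weight_three] at this
        refine Subtype.ext (Finsupp.ext fun i => ?_)
        fin_cases i
        · change d - (a * e.1 1 + b * e.1 2) = e.1 0
          omega
        · rfl
        · rfl
      right_inv := fun v => rfl }
  rw [Sd, MvPolynomial.weightedHomogeneousSubmodule_eq_finsupp_supported, ← Fintype.card_coe]
  exact Module.finrank_eq_card_basis ((MvPolynomial.basisRestrictSupport F _).reindex e)

end Dimension

theorem IsWeights.mul_le {g a' b' k a b d q : ℕ} (hw : IsWeights g a' b' k a b d)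
    (hdq : d ≤ q) : k * b' ≤ q :=
  (Nat.le_mul_of_pos_left _ hw.a_pos).trans (hw.d_eq_a_mul ▸ hdq)

/-! ### Parameters of the code -/

section Code

variable {F : Type*} [Field F] [Fintype F] {g a' b' k a b d : ℕ}

theorem le_hammingNorm_evalMap (hw : IsWeights g a' b' k a b d) (hab : a ≤ b)
    (hdq : d ≤ Fintype.card F) (hd : ∀ i, (![1, a, b] : Fin 3 → ℕ) i ∣ d)
    {p : Sd F ![1, a, b] d} (hp : p ≠ 0) :
    Fintype.card F ^ 2 + Fintype.card F - k * b' * Fintype.card F ≤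
      (open Classical in hammingNorm (evalMap ![1, a, b] d hd p)) := by
  have h1 := hammingNorm_evalMap_add hw hd p
  have h2 := zeros_le hw hab hdq p.2 (fun h => hp (Subtype.ext h))
  omega

theorem designed_distance_pos (hw : IsWeights g a' b' k a b d) (hdq : d ≤ Fintype.card F) :
    0 < Fintype.card F ^ 2 + Fintype.card F - k * b' * Fintype.card F := by
  have h1 := Nat.mul_le_mul_right (Fintype.card F) (hw.mul_le hdq)
  have h2 : 0 < Fintype.card F := Fintype.card_pos
  rw [pow_two]
  omega

/-- A nonzero form has weight at least the designed distance, which is positive because `k b' ≤ q`.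
-/
theorem evalMap_injective (hw : IsWeights g a' b' k a b d) (hab : a ≤ b)
    (hdq : d ≤ Fintype.card F) (hd : ∀ i, (![1, a, b] : Fin 3 → ℕ) i ∣ d) :
    Function.Injective (evalMap (F := F) ![1, a, b] d hd) := by
  classical
  rw [injective_iff_map_eq_zero]
  intro p h
  by_contra hp
  have h1 := le_hammingNorm_evalMap hw hab hdq hd hp
  rw [h, hammingNorm_zero] at h1
  exact absurd (designed_distance_pos hw hdq) (by omega)

theorem finrank_WPRM (hw : IsWeights g a' b' k a b d) (hab : a ≤ b)
    (hdq : d ≤ Fintype.card F) (hd : ∀ i, (![1, a, b] : Fin 3 → ℕ) i ∣ d) :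
    Module.finrank F (WPRM F ![1, a, b] d hd) =
      (latticePoints a b d (k * b') (k * a')).card := by
  rw [WPRM, LinearMap.finrank_range_of_inj (evalMap_injective hw hab hdq hd), finrank_Sd hw]

/-- A product of `d / a` curves `x₁ = c x₀ ^ a` has the largest number of zeros. -/
theorem exists_hammingNorm_evalMap_eq (hw : IsWeights g a' b' k a b d)
    (hdq : d ≤ Fintype.card F) (hd : ∀ i, (![1, a, b] : Fin 3 → ℕ) i ∣ d) :
    ∃ p : Sd F ![1, a, b] d,
      (open Classical in hammingNorm (evalMap ![1, a, b] d hd p)) =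
        Fintype.card F ^ 2 + Fintype.card F - k * b' * Fintype.card F := by
  classical
  -- The condition `k b' ≤ q` leaves room for `k b'` distinct values `c` in `F`.
  obtain ⟨S, -, hS⟩ := Finset.exists_subset_card_eq
    (s := (Finset.univ : Finset F)) (n := k * b') (by simpa using hw.mul_le hdq)
  let r : MvPolynomial (Fin 3) F :=
    ∏ c ∈ S, (MvPolynomial.X 1 - MvPolynomial.C c * MvPolynomial.X 0 ^ a)
  have hr : r ∈ Sd F ![1, a, b] d := by
    have hX := fun i => MvPolynomial.isWeightedHomogeneous_X F (![1, a, b] : Fin 3 → ℕ) i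
    have h1 : ∀ c ∈ S, (MvPolynomial.X 1 - MvPolynomial.C c * MvPolynomial.X 0 ^ a :
        MvPolynomial (Fin 3) F).IsWeightedHomogeneous (![1, a, b] : Fin 3 → ℕ) a := by
      intro c _
      have h2 := (MvPolynomial.isWeightedHomogeneous_C (![1, a, b] : Fin 3 → ℕ) c).mul
        ((hX 0).pow a)
      have h3 : 0 + a • (![1, a, b] : Fin 3 → ℕ) 0 = a := by simp
      rw [h3] at h2
      exact (hX 1).sub h2
    have h4 := MvPolynomial.IsWeightedHomogeneous.prod S _ (fun _ => a) h1
    rw [Finset.sum_const, hS, smul_eq_mul, mul_comm, ← hw.d_eq_a_mul] at h4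
    exact h4
  have heval : ∀ x₀ x₁ x₂ : F, MvPolynomial.eval ![x₀, x₁, x₂] r =
      ∏ c ∈ S, (x₁ - c * x₀ ^ a) := fun x₀ x₁ x₂ => by simp [r]
  have heval0 : ∀ x₁ x₂ : F, MvPolynomial.eval ![0, x₁, x₂] r = x₁ ^ (k * b') := by
    intro x₁ x₂
    simp [heval, zero_pow hw.a_pos.ne', hS]
  have haff : affZeros (dehom r) = k * b' * Fintype.card F := by
    have h1 : affZeros (dehom r) = Nat.card (S × F) := by
      unfold affZeros
      refine Nat.card_congr
        { toFun := fun v => (⟨v.1.1, ?_⟩, v.1.2)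
          invFun := fun v => ⟨(v.1.1, v.2), ?_⟩
          left_inv := fun v => rfl
          right_inv := fun v => rfl }
      · obtain ⟨c, hc, h⟩ := Finset.prod_eq_zero_iff.mp
          ((heval _ _ _).symm.trans ((eval_map_dehom r _ _).symm.trans v.2))
        have : v.1.1 = c := by simpa [sub_eq_zero] using h
        rwa [this]
      · rw [eval_map_dehom, heval]
        exact Finset.prod_eq_zero v.1.2 (by simp)
    rw [h1, Nat.card_prod, Nat.card_eq_fintype_card, Nat.card_eq_fintype_card, Fintype.card_coe,
      hS]
  have hpos : k * b' ≠ 0 := (Nat.mul_pos hw.k_pos hw.b'_pos).ne'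
  -- At infinity the product is `x₁ ^ (k b')`, which vanishes only at `z = 0`. This one zero
  -- accounts for the `+ 1` in the bound.
  have htop : Nat.card {z : F // (topPoly a' b' k (dehom r)).eval z = 0} = 1 := by
    have h1 : ∀ z : F, (topPoly a' b' k (dehom r)).eval z = 0 ↔ z = 0 := by
      intro z
      obtain ⟨y₁, y₂, hy₂, hy⟩ := exists_coords hw.b'_pos hw.coprime z
      have h2 := eval_zero_eq hw hr hy
      rw [heval0] at h2
      have h3 : y₁ = 0 ↔ z = 0 := by
        rw [← pow_eq_zero_iff hw.b'_pos.ne', hy, mul_eq_zero,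
          or_iff_left (pow_ne_zero _ hy₂)]
      rw [← h3, ← pow_eq_zero_iff (a := y₁) hpos, h2, mul_eq_zero, or_iff_right (pow_ne_zero _ hy₂)]
    simp only [h1]
    exact Nat.card_unique
  refine ⟨⟨r, hr⟩, ?_⟩
  have h1 := hammingNorm_evalMap_add hw hd ⟨r, hr⟩
  dsimp only at h1
  rw [haff, htop, ← eval_zero_one_zero hw hr, heval0, one_pow, if_neg one_ne_zero] at h1
  omega

end Code

end WProj

theorem mainTheorem4 {F : Type*} [Field F] [Fintype F] (a b d k : ℕ)
    (ha : 0 < a) (hab : a ≤ b) (hk : 0 < k) (hd : d = k * Nat.lcm a b)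
    (hdq : d ≤ Fintype.card F) :
    Fintype.card (WProj.RatPoint F ![1, a, b]) =
        Fintype.card F ^ 2 + Fintype.card F + 1 ∧
      (Module.finrank F (WProj.WPRM F ![1, a, b] d (WProj.dvd_of_eq_mul_lcm hd)) : ℚ) =
        (((d : ℚ) + 2 * a) * (d + b) + ((Nat.gcd a b : ℚ) - a) * d) / (2 * a * b) ∧
      ∃ δ : ℕ,
        WProj.IsMinDist (WProj.WPRM F ![1, a, b] d (WProj.dvd_of_eq_mul_lcm hd)) δ ∧
          (δ : ℚ) = (Fintype.card F : ℚ) ^ 2 - ((d : ℚ) / a - 1) * Fintype.card F := by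
  classical
  obtain ⟨a', b', hc, ha', hb'⟩ := Nat.exists_coprime a b
  obtain ⟨g, hg⟩ : ∃ g, g = Nat.gcd a b := ⟨_, rfl⟩
  rw [← hg] at ha' hb'
  have hgpos : 0 < g := hg ▸ Nat.gcd_pos_of_pos_left b ha
  have hw : WProj.IsWeights g a' b' k a b d :=
    { g_pos := hgpos
      a'_pos := Nat.pos_of_mul_pos_right (ha' ▸ ha)
      b'_pos := Nat.pos_of_mul_pos_right (hb' ▸ ha.trans_le hab)
      k_pos := hk
      coprime := hc
      a_eq := ha'.trans (mul_comm _ _)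
      b_eq := hb'.trans (mul_comm _ _)
      d_eq := by
        rw [hd, ha', hb', Nat.lcm_mul_right, hc.lcm_eq_mul]
        ring }
  have haQ : (a : ℚ) = g * a' := by exact_mod_cast hw.a_eq
  have hbQ : (b : ℚ) = g * b' := by exact_mod_cast hw.b_eq
  have hdQ : (d : ℚ) = k * (g * a' * b') := by exact_mod_cast hw.d_eq
  have hg0 : (g : ℚ) ≠ 0 := by exact_mod_cast hw.g_pos.ne'
  have ha0 : (a' : ℚ) ≠ 0 := by exact_mod_cast hw.a'_pos.ne'
  have hb0 : (b' : ℚ) ≠ 0 := by exact_mod_cast hw.b'_pos.ne'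
  refine ⟨WProj.card_ratPoint hw, ?_,
    Fintype.card F ^ 2 + Fintype.card F - k * b' * Fintype.card F, ⟨?_, ?_⟩, ?_⟩
  · rw [WProj.finrank_WPRM hw hab hdq]
    have h1 : (2 : ℚ) * (WProj.latticePoints a b d (k * b') (k * a')).card =
        (k * b' + 1) * (k * a' + 1) + (k + 1) := by
      exact_mod_cast WProj.two_mul_card_latticePoints hw
    rw [← hg, haQ, hbQ, hdQ, eq_div_iff (by positivity)]
    linear_combination (g * a' * (g * b') : ℚ) * h1
  · obtain ⟨p, hp⟩ := WProj.exists_hammingNorm_evalMap_eq (F := F) hw hdq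
      (WProj.dvd_of_eq_mul_lcm hd)
    refine ⟨_, ⟨p, rfl⟩, fun h0 => ?_, hp⟩
    rw [h0, hammingNorm_zero] at hp
    exact (WProj.designed_distance_pos hw hdq).ne hp
  · rintro w ⟨_, ⟨p, rfl⟩, hne, rfl⟩
    refine WProj.le_hammingNorm_evalMap hw hab hdq _ fun h => hne ?_
    rw [h, map_zero]
  · rw [Nat.cast_sub (by
      have := Nat.mul_le_mul_right (Fintype.card F) (hw.mul_le hdq)
      rw [pow_two]
      omega)]
    push_cast
    rw [haQ, hdQ]
    field_simp
    ring
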